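/- For $n\ge 1$, a complete increasing tree of size $n$ is a planar binary tree with $n$ nodes labeled bijectively by $1,\dots,n$, the root being labeled $1$, in which each child is either a left child or a right child, the label of each node is smaller than the labels of its children, and every node is either a leaf or has two children, except that when $n$ is even the rightmost node (the last node on the path of right children starting at the root) has a left child and no right child. For such a tree $t$, let $\mathrm{eoc}(t)$ (end of the minimal chain) be the label of the leaf reached by starting at the root and moving at each interior node to its child of smallest label, and for $n\ge 2$ let $\mathrm{pom}(t)$ be the label of the parent of the leaf labeled $n$. For $n\ge 1$ let $f_{2n}(m,k)$ be the number of complete increasing trees $t$ of size $2n$ with $\mathrm{eoc}(t)=m$ and $\mathrm{pom}(t)=k$ (it is $0$ unless $2\le m\le 2n$ and $1\le k\le 2n-1$), and put $$f_{2n}(m,\bullet)=\sum_{k=1}^{2n-1} f_{2n}(m,k),\qquad f_{2n}(\bullet,k)=\sum_{m=2}^{2n} f_{2n}(m,k),\qquad f_{2n}(\bullet,\bullet)=\sum_{m=2}^{2n}\sum_{k=1}^{2n-1} f_{2n}(m,k).$$ Let the secant numbers $E_{2n}$ be defined by $\sec u=\sum_{n\ge 0}E_{2n}\,u^{2n}/(2n)!$,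 and for a function $g$ of an integer $j$ let $\Delta_j g(j)=g(j+1)-g(j)$. Proposition 1.3. We have $$f_2(\bullet,1)=1;\qquad f_{2n}(\bullet,1)=f_{2n-2}(\bullet,\bullet)=E_{2n-2}\quad (n\ge 2);$$ $$f_{2n}(\bullet,2)=3f_{2n-2}(\bullet,\bullet)=3E_{2n-2}\quad (n\ge 2);$$ and, for $n\ge 2$, $$\Delta_m^2\, f_{2n}(m,\bullet)+4 f_{2n-2}(m,\bullet)=0\quad (2\le m\le 2n-2);\tag{R3}$$ $$\Delta_k^2\, f_{2n}(\bullet,k)+4 f_{2n-2}(\bullet,k)=0\quad (1\le k\le 2n-3).\tag{R4}$$ -/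

import Mathlib

open BinaryTree

namespace SecantTree

/-- The label of the root of a binary tree (`none` for the empty tree). -/
def rootLabel : BinaryTree ℕ → Option ℕ
  | nil => none
  | node a _ _ => some a

/-- The labels of the nodes, read from left to right (the projection of the planar tree onto a
horizontal axis). -/
def projection : BinaryTree ℕ → List ℕ
  | nil => []
  | node a l r => projection l ++ a :: projection r

/-- The label of each node is smaller than the labels of its children, if any. -/
def IsIncreasing : BinaryTree ℕ → Prop
  | nil => True
  | node a l r => (∀ b ∈ rootLabel l, a < b) ∧ (∀ c ∈ rootLabel r, a < c) ∧
      IsIncreasing l ∧ IsIncreasing r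

/-- Every node is either a leaf or a node with two children. -/
def IsFull : BinaryTree ℕ → Prop
  | nil => True
  | node _ l r => (l = nil ↔ r = nil) ∧ IsFull l ∧ IsFull r

/-- The shape condition on a nonempty tree of size `n`: every node is either a leaf or a node with
two children, except that, when `n` is even, the rightmost node has a left child and no right child.
The recursion follows the path of right children from the root; the rightmost node is the one
on this path that has no right child. -/
def IsCompleteShape (n : ℕ) : BinaryTree ℕ → Prop
  | nil => False
  | node _ l nil => (Even n ↔ l ≠ nil) ∧ IsFull l
  | node _ l (node b l' r') => l ≠ nil ∧ IsFull l ∧ IsCompleteShape n (node b l' r')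

/-- The set of complete increasing trees of size `n`: increasing planar binary trees whose `n` nodes
are labeled bijectively with `1, …, n` (the root being labeled `1`) and which are complete. For even
`n` these are the secant trees. -/
def completeIncreasingTrees (n : ℕ) : Set (BinaryTree ℕ) :=
  {t | (projection t).Perm (List.range' 1 n) ∧ rootLabel t = some 1 ∧ IsIncreasing t ∧
    IsCompleteShape n t}

/-- The end of the minimal chain: starting from the root, move at each interior node to its child
with the smallest label (or to its only child), until a leaf is reached; return the label of that
leaf (`none` for the empty tree). -/
def eoc : BinaryTree ℕ → Option ℕ
  | nil => none
  | node a l r =>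
    match rootLabel l, rootLabel r with
    | none, none => some a
    | some _, none => eoc l
    | none, some _ => eoc r
    | some b, some c => if b < c then eoc l else eoc r

/-- The label of the parent of the node labeled `x` (`none` if there is no such parent). -/
def parentOf (x : ℕ) : BinaryTree ℕ → Option ℕ
  | nil => none
  | node a l r =>
    if rootLabel l = some x ∨ rootLabel r = some x then some a
    else (parentOf x l).or (parentOf x r)

/-- The parent of the maximum leaf: in a tree labeled with `1, …, n`, the label of the parent of the
leaf labeled `n`. -/
def pom (t : BinaryTree ℕ) : Option ℕ := parentOf t.numNodes t

/-- The set counted below is finite, so that its `Set.ncard` is its true cardinality. -/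
theorem finite_completeIncreasingTrees (n : ℕ) : (completeIncreasingTrees n).Finite := by
  have key : ∀ h : ℕ,
      {t : BinaryTree ℕ | (projection t).length ≤ h ∧ ∀ x ∈ projection t, x ≤ n}.Finite := by
    intro h
    induction h with
    | zero =>
      refine (Set.finite_singleton nil).subset ?_
      rintro (_ | ⟨a, l, r⟩) ⟨h1, -⟩
      · rfl
      · simp [projection] at h1
    | succ h ih =>
      refine (((((Set.finite_Iic n).prod (ih.prod ih)).image
        (fun p : ℕ × BinaryTree ℕ × BinaryTree ℕ => node p.1 p.2.1 p.2.2))).insert nil).subset ?_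
      rintro (_ | ⟨a, l, r⟩) ⟨h1, h2⟩
      · exact Set.mem_insert _ _
      · refine Set.mem_insert_of_mem _ ⟨(a, l, r), ?_, rfl⟩
        simp only [projection, List.length_append, List.length_cons, List.mem_append,
          List.mem_cons] at h1 h2
        exact ⟨h2 a (by simp), ⟨by dsimp only; omega, fun x hx => h2 x (by simp [hx])⟩,
          ⟨by dsimp only; omega, fun x hx => h2 x (by simp [hx])⟩⟩
  refine (key n).subset ?_
  rintro t ⟨h1, -⟩
  refine ⟨by simpa using h1.length_eq.le, fun x hx => ?_⟩
  have := h1.mem_iff.1 hx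
  simp only [List.mem_range'_1] at this
  omega

/-- `f n m k` is the number of complete increasing trees of size `n` with `eoc = m` and `pom = k`.
For `n ≥ 2` it vanishes unless `2 ≤ m ≤ n` and `1 ≤ k ≤ n - 1`. -/
noncomputable def f (n m k : ℕ) : ℕ :=
  {t ∈ completeIncreasingTrees n | eoc t = some m ∧ pom t = some k}.ncard

/-- The row sum `f n m •`. -/
noncomputable def rowSum (n m : ℕ) : ℕ := ∑ k ∈ Finset.Icc 1 (n - 1), f n m k

/-- The column sum `f n • k`. -/
noncomputable def colSum (n k : ℕ) : ℕ := ∑ m ∈ Finset.Icc 2 n, f n m k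

/-- The total sum `f n • •`. -/
noncomputable def totalSum (n : ℕ) : ℕ :=
  ∑ m ∈ Finset.Icc 2 n, ∑ k ∈ Finset.Icc 1 (n - 1), f n m k

/-- For even `n`, the secant number `E n`: the coefficient of `u ^ n / n!` in the Taylor series of
`sec u = 1 / cos u`. -/
noncomputable def secantNumber (n : ℕ) : ℚ :=
  (n.factorial : ℚ) * PowerSeries.coeff n (PowerSeries.cos ℚ)⁻¹

end SecantTree

namespace SecantTree

/-! Delete the labels of a secant tree in increasing order. What remains at each stage is a forest:
an ordered list of `s` full trees and one spinal tree, possibly empty. The smallest remaining label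
is a root. It is a one-node full tree (`s` positions, leaving `s - 1` full trees), or the root of a
larger full tree (`s` positions, leaving `s + 1`), or the root of the spinal tree (one way, leaving
`s + 1`). Forests are therefore counted by weighted paths, generated by `(A g)(s) = s g(s - 1) + (s
+ 1) g(s + 1)` from the indicator `δ` of height 0 (`card_forests`). Differentiation acts on the
series `sec * tan ^ s` by the same rule, so paths from height 0 give the secant numbers.

Each statistic marks one step of the path. When the deleted node is the parent of the largest label,
its step is multiplication `M` by `2 s + 1`, and column sums are values at 0 of `A^d M A^(n-d-2) δ`
(`card_forestHasParent`). A second difference in `d` produces the double commutator, and `[A, [A,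
M]] = -4 M` is the column recurrence.

For the minimal chain one follows the two subtrees between which it chooses: initially a full tree
and the spinal tree, possibly two full trees later (`pairSum_succ`, `spineSum_succ`). Until the
chain ends, the count evolves by an operator `T` on pairs of functions. With `ι` the step that ends
the chain, row sums come from `T^d ι A^(n-d-2) δ` for trees of size `n`, and the row recurrence is
`T² ι - 2 T ι A + ι A² = -4 ι`. The values at `k = 1, 2` are the weights `2 s + 1` at `s = 0, 1`. -/

/-! ### Weighted path counts and their second differences. -/

/-- Weighted lattice paths of length `n` from height `s` to height `0`: a step from `s` down to
`s - 1` has weight `s`, a step up to `s + 1` has weight `s + 1`. -/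
def pathCount : ℕ → ℕ → ℕ
  | 0, 0 => 1
  | 0, _ + 1 => 0
  | n + 1, s => s * pathCount n (s - 1) + (s + 1) * pathCount n (s + 1)

/-- Weighted paths in which the step number `d` places the parent of the maximal label. -/
def pomCount : ℕ → ℕ → ℕ → ℕ
  | 0, _, _ => 0
  | n + 1, 0, s => (2 * s + 1) * pathCount (n - 1) s
  | n + 1, d + 1, s => s * pomCount n d (s - 1) + (s + 1) * pomCount n d (s + 1)

/-- Weighted paths in which the step number `d` ends the minimal chain, when the chain continues
in one of two full trees, accompanied by `q` other full trees and a spinal tree. -/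
def pairEocCount : ℕ → ℕ → ℕ → ℕ
  | 0, _, _ => 0
  | n + 1, 0, q => 2 * pathCount n (q + 1)
  | n + 1, d + 1, q => q * pairEocCount n d (q - 1) + (q + 3) * pairEocCount n d (q + 1)

/-- Weighted paths in which the step number `d` ends the minimal chain, when the chain continues
in a full tree or in the spinal tree, accompanied by `q` other full trees. -/
def spineEocCount : ℕ → ℕ → ℕ → ℕ
  | 0, _, _ => 0
  | n + 1, 0, q => pathCount n q
  | n + 1, d + 1, q =>
    q * spineEocCount n d (q - 1) + (q + 1) * spineEocCount n d (q + 1) + pairEocCount n d q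

theorem pomCount_succ_succ (n d s : ℕ) : pomCount (n + 1) (d + 1) s =
    s * pomCount n d (s - 1) + (s + 1) * pomCount n d (s + 1) := rfl

theorem pairEocCount_succ_succ (n d q : ℕ) : pairEocCount (n + 1) (d + 1) q =
    q * pairEocCount n d (q - 1) + (q + 3) * pairEocCount n d (q + 1) := rfl

theorem spineEocCount_succ_succ (n d q : ℕ) : spineEocCount (n + 1) (d + 1) q =
    q * spineEocCount n d (q - 1) + (q + 1) * spineEocCount n d (q + 1) + pairEocCount n d q := rfl

/-- The first `d` steps are common to all four terms, so linearity reduces to `d = 0`. There two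
unfoldings of `pathCount` verify `[A, [A, M]] = -4 M`; small `s` is separated because of the
truncated `s - 1`. -/
theorem pomCount_second_difference (d n s : ℕ) :
    (pomCount (n + d + 4) (d + 2) s : ℤ) - 2 * pomCount (n + d + 4) (d + 1) s
      + pomCount (n + d + 4) d s + 4 * pomCount (n + d + 2) d s = 0 := by
  induction d generalizing s with
  | zero =>
    rcases s with _ | _ | s <;> simp [pomCount, pathCount] <;> ring
  | succ d ih =>
    have h1 := ih (s - 1)
    have h2 := ih (s + 1)
    rw [show n + (d + 1) + 4 = (n + d + 4) + 1 by ring,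
      show n + (d + 1) + 2 = (n + d + 2) + 1 by ring]
    rw [show d + 1 + 2 = d + 2 + 1 from rfl, pomCount_succ_succ (n + d + 4) (d + 2) s,
      pomCount_succ_succ (n + d + 4) (d + 1) s, pomCount_succ_succ (n + d + 4) d s,
      pomCount_succ_succ (n + d + 2) d s]
    push_cast
    linear_combination (s : ℤ) * h1 + (s + 1 : ℤ) * h2

theorem pairEocCount_second_difference (d n q : ℕ) :
    (pairEocCount (n + d + 3) (d + 2) q : ℤ) - 2 * pairEocCount (n + d + 3) (d + 1) q
      + pairEocCount (n + d + 3) d q + 4 * pairEocCount (n + d + 1) d q = 0 := by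
  induction d generalizing q with
  | zero =>
    rcases q with _ | _ | q <;> simp [pairEocCount, pathCount] <;> ring
  | succ d ih =>
    have h1 := ih (q - 1)
    have h2 := ih (q + 1)
    rw [show n + (d + 1) + 3 = (n + d + 3) + 1 by ring,
      show n + (d + 1) + 1 = (n + d + 1) + 1 by ring]
    rw [show d + 1 + 2 = d + 2 + 1 from rfl, pairEocCount_succ_succ (n + d + 3) (d + 2) q,
      pairEocCount_succ_succ (n + d + 3) (d + 1) q, pairEocCount_succ_succ (n + d + 3) d q,
      pairEocCount_succ_succ (n + d + 1) d q]
    push_cast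
    linear_combination (q : ℤ) * h1 + (q + 3 : ℤ) * h2

/-- The recursion is triangular: the spinal state feeds into the pair state, whose own second
difference supplies the extra term `h3`. -/
theorem spineEocCount_second_difference (d n q : ℕ) :
    (spineEocCount (n + d + 3) (d + 2) q : ℤ) - 2 * spineEocCount (n + d + 3) (d + 1) q
      + spineEocCount (n + d + 3) d q + 4 * spineEocCount (n + d + 1) d q = 0 := by
  induction d generalizing q with
  | zero =>
    rcases q with _ | _ | q <;> simp [spineEocCount, pairEocCount, pathCount] <;> ring
  | succ d ih =>
    have h1 := ih (q - 1)
    have h2 := ih (q + 1)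
    have h3 := pairEocCount_second_difference d n q
    rw [show n + (d + 1) + 3 = (n + d + 3) + 1 by ring,
      show n + (d + 1) + 1 = (n + d + 1) + 1 by ring]
    rw [show d + 1 + 2 = d + 2 + 1 from rfl, spineEocCount_succ_succ (n + d + 3) (d + 2) q,
      spineEocCount_succ_succ (n + d + 3) (d + 1) q, spineEocCount_succ_succ (n + d + 3) d q,
      spineEocCount_succ_succ (n + d + 1) d q]
    push_cast
    linear_combination (q : ℤ) * h1 + (q + 1 : ℤ) * h2 + h3

/-! ### Secant numbers as path counts. -/

-- From `sec' = sec * tan` and `tan' = 1 + tan ^ 2`, the power contributes `s (tan ^ (s - 1) + tan ^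
-- (s + 1))` and the factor `sec` one more `tan ^ (s + 1)`: exactly the step weights of `pathCount`.
open PowerSeries in
theorem derivative_sec_mul_tan_pow (s : ℕ) :
    d⁄dX ℚ ((cos ℚ)⁻¹ * (sin ℚ * (cos ℚ)⁻¹) ^ s) =
      (s : ℚ⟦X⟧) * ((cos ℚ)⁻¹ * (sin ℚ * (cos ℚ)⁻¹) ^ (s - 1)) +
        (s + 1 : ℚ⟦X⟧) * ((cos ℚ)⁻¹ * (sin ℚ * (cos ℚ)⁻¹) ^ (s + 1)) := by
  have hsin : d⁄dX ℚ (sin ℚ) = cos ℚ := by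
    ext n
    simp only [coeff_derivative, sin, cos, coeff_mk, Nat.even_add_one, Nat.factorial_succ]
    have : (n.factorial : ℚ) ≠ 0 := by positivity
    rcases Nat.even_or_odd n with h | h
    · rw [if_neg (by simpa using h), if_pos h, show (n + 1) / 2 = n / 2 by
        obtain ⟨k, rfl⟩ := h; omega]
      simp
      field_simp
    · rw [if_pos (by simpa using h), if_neg (by simpa using h)]
      simp
  have hcos : d⁄dX ℚ (cos ℚ) = - sin ℚ := by
    ext n
    simp only [coeff_derivative, sin, cos, coeff_mk, Nat.even_add_one, Nat.factorial_succ, map_neg]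
    have : (n.factorial : ℚ) ≠ 0 := by positivity
    rcases Nat.even_or_odd n with h | h
    · rw [if_neg (by simpa using h), if_pos h]
      simp
    · rw [if_pos (by simpa using h), if_neg (by simpa using h), show (n + 1) / 2 = n / 2 + 1 by
        obtain ⟨k, rfl⟩ := h; omega]
      simp [pow_succ]
      field_simp
  have h0 : constantCoeff (cos ℚ) ≠ 0 := by
    rw [← coeff_zero_eq_constantCoeff_apply]; simp [cos]
  have hc : cos ℚ * (cos ℚ)⁻¹ = 1 := PowerSeries.mul_inv_cancel _ h0
  rw [Derivation.leibniz, derivative_pow, Derivation.leibniz, derivative_inv', hsin, hcos]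
  simp only [smul_eq_mul]
  rcases s with _ | s
  · simp; ring
  · simp only [Nat.add_sub_cancel]
    push_cast
    set c := (cos ℚ)⁻¹
    linear_combination (c * (s + 1) * (sin ℚ * c) ^ s) * hc

open PowerSeries in
theorem factorial_mul_coeff_sec_mul_tan_pow (n s : ℕ) :
    (n.factorial : ℚ) * coeff n ((cos ℚ)⁻¹ * (sin ℚ * (cos ℚ)⁻¹) ^ s) = pathCount n s := by
  induction n generalizing s with
  | zero =>
    have hc : constantCoeff (cos ℚ) = 1 := by
      rw [← coeff_zero_eq_constantCoeff_apply]; simp [cos]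
    have hs : constantCoeff (sin ℚ) = 0 := by
      rw [← coeff_zero_eq_constantCoeff_apply]; simp [sin]
    rcases s with _ | s <;> simp [pathCount, hc, hs]
  | succ n ih =>
    have h := congrArg (coeff n) (derivative_sec_mul_tan_pow s)
    rw [coeff_derivative, map_add, ← Nat.cast_succ s, ← map_natCast (C (R := ℚ)) s,
      ← map_natCast (C (R := ℚ)) (s + 1), coeff_C_mul, coeff_C_mul] at h
    rw [Nat.factorial_succ, pathCount]
    push_cast at h ⊢
    rw [← ih, ← ih]
    linear_combination (n.factorial : ℚ) * h

theorem secantNumber_eq_pathCount (n : ℕ) : secantNumber n = pathCount n 0 := by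
  rw [← factorial_mul_coeff_sec_mul_tan_pow, secantNumber, pow_zero, mul_one]

/-! ### Forests and deletion of the smallest label. -/

theorem le_of_mem_projection {t : BinaryTree ℕ} (h : IsIncreasing t) {a : ℕ}
    (ha : rootLabel t = some a) {x : ℕ} (hx : x ∈ projection t) : a ≤ x := by
  induction t generalizing a with
  | nil => simp [projection] at hx
  | node b l r ihl ihr =>
    obtain ⟨hl, hr, hil, hir⟩ := h
    simp only [rootLabel, Option.some.injEq] at ha
    subst ha
    simp only [projection, List.mem_append, List.mem_cons] at hx
    rcases hx with hx | rfl | hx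
    · cases l with
      | nil => simp [projection] at hx
      | node c l1 l2 => exact (hl c rfl).le.trans (ihl hil rfl hx)
    · exact le_rfl
    · cases r with
      | nil => simp [projection] at hx
      | node c r1 r2 => exact (hr c rfl).le.trans (ihr hir rfl hx)

theorem rootLabel_mem_projection {t : BinaryTree ℕ} {a : ℕ} (h : rootLabel t = some a) :
    a ∈ projection t := by
  cases t with
  | nil => simp [rootLabel] at h
  | node b l r => simp_all [rootLabel, projection]

/-- A spinal tree: the nodes on the path of right children from the root all have a left child that
is a full tree. -/
def IsSpinal : BinaryTree ℕ → Prop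
  | nil => True
  | node _ l r => l ≠ nil ∧ IsFull l ∧ IsSpinal r

/-- Spinality does not mention the size, so it survives deletion of the root; the empty spinal tree
is what remains below the last spine node. -/
theorem isCompleteShape_iff {n : ℕ} (hn : Even n) (t : BinaryTree ℕ) :
    IsCompleteShape n t ↔ t ≠ nil ∧ IsSpinal t := by
  induction t with
  | nil => simp [IsCompleteShape]
  | node a l r _ ih =>
    cases r with
    | nil => simp [IsCompleteShape, IsSpinal, hn]
    | node b l' r' => simp only [IsCompleteShape, IsSpinal, ih]; simp

/-- The labels of a forest, which consists of a list of trees and a last tree. -/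
def forestLabels (p : List (BinaryTree ℕ) × BinaryTree ℕ) : List ℕ :=
  p.1.flatMap projection ++ projection p.2

/-- A forest with label list `ls`: a list of `s` nonempty full increasing trees, together with an
increasing spinal tree. -/
structure IsForest (ls : List ℕ) (s : ℕ) (p : List (BinaryTree ℕ) × BinaryTree ℕ) : Prop where
  length_eq : p.1.length = s
  full : ∀ t ∈ p.1, t ≠ nil ∧ IsFull t ∧ IsIncreasing t
  spinal : IsSpinal p.2
  increasing : IsIncreasing p.2
  perm : (forestLabels p).Perm ls

theorem isForest_leaf_iff {a s : ℕ} {ls : List ℕ} {pre post : List (BinaryTree ℕ)}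
    {u : BinaryTree ℕ} :
    IsForest (a :: ls) (s + 1) (pre ++ node a nil nil :: post, u) ↔
      IsForest ls s (pre ++ post, u) := by
  have hp : (forestLabels (pre ++ node a nil nil :: post, u)).Perm
      (a :: forestLabels (pre ++ post, u)) := by
    refine List.perm_iff_count.2 fun x => ?_
    simp [forestLabels, projection, List.count_append, List.count_cons]
    omega
  constructor
  · rintro ⟨h1, h2, h3, h4, h5⟩
    refine ⟨?_, fun t ht => h2 t ?_, h3, h4, (List.perm_cons a).1 (hp.symm.trans h5)⟩
    · simp at h1 ⊢; omega
    · simp at ht ⊢; tauto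
  · rintro ⟨h1, h2, h3, h4, h5⟩
    refine ⟨?_, fun t ht => ?_, h3, h4, hp.trans (h5.cons a)⟩
    · simp at h1 ⊢; omega
    · simp only [List.mem_append, List.mem_cons] at ht
      rcases ht with ht | rfl | ht
      · exact h2 t (by simp [ht])
      · simp [IsFull, IsIncreasing, rootLabel]
      · exact h2 t (by simp [ht])

theorem isForest_join_iff {a s : ℕ} {ls : List ℕ} (ha : ∀ x ∈ ls, a < x)
    {pre post : List (BinaryTree ℕ)} {l r u : BinaryTree ℕ} (hl : l ≠ nil) :
    IsForest (a :: ls) s (pre ++ node a l r :: post, u) ↔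
      IsForest ls (s + 1) (pre ++ l :: r :: post, u) := by
  have hp : (forestLabels (pre ++ node a l r :: post, u)).Perm
      (a :: forestLabels (pre ++ l :: r :: post, u)) := by
    refine List.perm_iff_count.2 fun x => ?_
    simp [forestLabels, projection, List.count_append, List.count_cons]
    omega
  constructor
  · rintro ⟨h1, h2, h3, h4, h5⟩
    obtain ⟨-, ⟨e, hfl, hfr⟩, -, -, hil, hir⟩ := h2 (node a l r) (by simp)
    refine ⟨?_, fun t ht => ?_, h3, h4, (List.perm_cons a).1 (hp.symm.trans h5)⟩
    · simp at h1 ⊢; omega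
    · simp only [List.mem_append, List.mem_cons] at ht
      rcases ht with ht | rfl | rfl | ht
      · exact h2 t (by simp [ht])
      · exact ⟨hl, hfl, hil⟩
      · exact ⟨fun h => hl (e.2 h), hfr, hir⟩
      · exact h2 t (by simp [ht])
  · rintro ⟨h1, h2, h3, h4, h5⟩
    obtain ⟨-, hfl, hil⟩ := h2 l (by simp)
    obtain ⟨hr, hfr, hir⟩ := h2 r (by simp)
    refine ⟨?_, fun t ht => ?_, h3, h4, hp.trans (h5.cons a)⟩
    · simp at h1 ⊢; omega
    · simp only [List.mem_append, List.mem_cons] at ht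
      rcases ht with ht | rfl | ht
      · exact h2 t (by simp [ht])
      · refine ⟨by simp, ⟨by simp [hl, hr], hfl, hfr⟩, fun b hb => ?_, fun b hb => ?_, hil, hir⟩
        · exact ha b (h5.mem_iff.1 (by
            simp [forestLabels, rootLabel_mem_projection hb]))
        · exact ha b (h5.mem_iff.1 (by
            simp [forestLabels, rootLabel_mem_projection hb]))
      · exact h2 t (by simp [ht])

/-- Deleting the spine root puts its left subtree at the front of the list, a fixed position, so
this move has weight one. -/
theorem isForest_spine_iff {a s : ℕ} {ls : List ℕ} (ha : ∀ x ∈ ls, a < x)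
    {ts : List (BinaryTree ℕ)} {l r : BinaryTree ℕ} :
    IsForest (a :: ls) s (ts, node a l r) ↔ IsForest ls (s + 1) (l :: ts, r) := by
  have hp : (forestLabels (ts, node a l r)).Perm (a :: forestLabels (l :: ts, r)) := by
    refine List.perm_iff_count.2 fun x => ?_
    simp [forestLabels, projection, List.count_append, List.count_cons]
    omega
  constructor
  · rintro ⟨h1, h2, ⟨hl, hfl, hr⟩, ⟨-, -, hil, hir⟩, h5⟩
    refine ⟨?_, fun t ht => ?_, hr, hir, (List.perm_cons a).1 (hp.symm.trans h5)⟩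
    · simp at h1 ⊢; omega
    · simp only [List.mem_cons] at ht
      rcases ht with rfl | ht
      · exact ⟨hl, hfl, hil⟩
      · exact h2 t ht
  · rintro ⟨h1, h2, h3, h4, h5⟩
    obtain ⟨hl, hfl, hil⟩ := h2 l (by simp)
    refine ⟨?_, fun t ht => h2 t (by simp [show t ∈ ts from ht]), ⟨hl, hfl, h3⟩,
      ⟨fun b hb => ?_, fun b hb => ?_, hil, h4⟩, hp.trans (h5.cons a)⟩
    · simp at h1 ⊢; omega
    · exact ha b (h5.mem_iff.1 (by
        simp [forestLabels, rootLabel_mem_projection hb]))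
    · exact ha b (h5.mem_iff.1 (by
        simp [forestLabels, rootLabel_mem_projection hb]))

/-- Insert a leaf labeled `a` at position `i`. -/
def insLeaf (a : ℕ) : ℕ → List (BinaryTree ℕ) → List (BinaryTree ℕ)
  | 0, ts => node a nil nil :: ts
  | _ + 1, [] => []
  | i + 1, t :: ts => t :: insLeaf a i ts

/-- Join the trees at positions `i` and `i + 1` below a new root labeled `a`. -/
def joinAt (a : ℕ) : ℕ → List (BinaryTree ℕ) → List (BinaryTree ℕ)
  | 0, l :: r :: ts => node a l r :: ts
  | 0, _ => []
  | _ + 1, [] => []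
  | i + 1, t :: ts => t :: joinAt a i ts

/-- Join the first tree of a forest and the last tree below a new root labeled `a`. -/
def spineJoin (a : ℕ) (p : List (BinaryTree ℕ) × BinaryTree ℕ) :
    List (BinaryTree ℕ) × BinaryTree ℕ :=
  (p.1.tail, node a (p.1.headD nil) p.2)

theorem spineJoin_cons (a : ℕ) (ts : List (BinaryTree ℕ)) (l u : BinaryTree ℕ) :
    spineJoin a (l :: ts, u) = (ts, node a l u) := rfl

theorem insLeaf_append (a : ℕ) (pre post : List (BinaryTree ℕ)) :
    insLeaf a pre.length (pre ++ post) = pre ++ node a nil nil :: post := by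
  induction pre with
  | nil => simp [insLeaf]
  | cons t pre ih => simp [insLeaf, ih]

theorem joinAt_append (a : ℕ) (pre post : List (BinaryTree ℕ)) (l r : BinaryTree ℕ) :
    joinAt a pre.length (pre ++ l :: r :: post) = pre ++ node a l r :: post := by
  induction pre with
  | nil => simp [joinAt]
  | cons t pre ih => simp [joinAt, ih]

theorem exists_eq_append {α : Type*} {ts : List α} {i : ℕ} (h : i ≤ ts.length) :
    ∃ pre post, ts = pre ++ post ∧ pre.length = i :=
  ⟨ts.take i, ts.drop i, by simp, by simpa using h⟩

theorem exists_eq_append_pair {α : Type*} {ts : List α} {i : ℕ}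
    (h : i + 1 < ts.length) : ∃ pre l r post, ts = pre ++ l :: r :: post ∧ pre.length = i := by
  refine ⟨ts.take i, ts[i], ts[i + 1], ts.drop (i + 2), ?_, by simp; omega⟩
  rw [← List.drop_eq_getElem_cons h, ← List.drop_eq_getElem_cons (by omega)]
  simp

/-- In an increasing forest the least label must be a root. Conversely, placing a label smaller than
all others at a root keeps the forest increasing. -/
theorem isForest_cons_iff {a s : ℕ} {ls : List ℕ} (ha : ∀ x ∈ ls, a < x)
    (p : List (BinaryTree ℕ) × BinaryTree ℕ) :
    IsForest (a :: ls) s p ↔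
      (∃ i < s, ∃ q, IsForest ls (s - 1) q ∧ (insLeaf a i q.1, q.2) = p) ∨
      (∃ i < s, ∃ q, IsForest ls (s + 1) q ∧ (joinAt a i q.1, q.2) = p) ∨
      ∃ q, IsForest ls (s + 1) q ∧ spineJoin a q = p := by
  constructor
  · intro h
    obtain ⟨ts, u⟩ := p
    have hmin : ∀ t : BinaryTree ℕ, IsIncreasing t → (∀ x ∈ projection t, x ∈ a :: ls) →
        a ∈ projection t → ∃ l r, t = node a l r := by
      intro t hinc hsub hat
      cases t with
      | nil => simp [projection] at hat
      | node b l r =>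
        have h1 := le_of_mem_projection hinc rfl hat
        have h2 := hsub b (by simp [projection])
        rcases List.mem_cons.1 h2 with rfl | h2
        · exact ⟨l, r, rfl⟩
        · exact absurd (ha b h2) (by omega)
    have hmem : a ∈ forestLabels (ts, u) := h.perm.mem_iff.2 (by simp)
    simp only [forestLabels, List.mem_append, List.mem_flatMap] at hmem
    rcases hmem with ⟨t, ht, hat⟩ | hau
    · obtain ⟨l, r, rfl⟩ := hmin t (h.full t ht).2.2 (fun x hx => h.perm.mem_iff.1 (by
        simp only [forestLabels, List.mem_append, List.mem_flatMap]
        exact Or.inl ⟨t, ht, hx⟩)) hat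
      have hiff := (h.full _ ht).2.1.1
      obtain ⟨pre, post, rfl⟩ := List.append_of_mem ht
      have hlen : pre.length < s := by
        rw [← h.length_eq]; simp
      by_cases hl : l = nil
      · left
        obtain rfl := hiff.1 hl
        subst hl
        obtain ⟨s, rfl⟩ : ∃ s', s = s' + 1 := ⟨s - 1, by omega⟩
        exact ⟨pre.length, hlen, (pre ++ post, u), isForest_leaf_iff.1 h, by
          simp [insLeaf_append]⟩
      · right; left
        exact ⟨pre.length, hlen, (pre ++ l :: r :: post, u), (isForest_join_iff ha hl).1 h, by
          simp [joinAt_append]⟩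
    · right; right
      obtain ⟨l, r, rfl⟩ := hmin u h.increasing (fun x hx => h.perm.mem_iff.1 (by
        simp only [forestLabels, List.mem_append]
        exact Or.inr hx)) hau
      exact ⟨(l :: ts, r), (isForest_spine_iff ha).1 h, by simp [spineJoin]⟩
  · rintro (⟨i, hi, ⟨ts, u⟩, hq, rfl⟩ | ⟨i, hi, ⟨ts, u⟩, hq, rfl⟩ | ⟨⟨ts, u⟩, hq, rfl⟩)
    · obtain ⟨s, rfl⟩ : ∃ s', s = s' + 1 := ⟨s - 1, by omega⟩
      have := hq.length_eq
      obtain ⟨pre, post, rfl, rfl⟩ := exists_eq_append (ts := ts) (i := i) (by simp at this; omega)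
      simp only [insLeaf_append]
      exact isForest_leaf_iff.2 hq
    · have := hq.length_eq
      obtain ⟨pre, l, r, post, rfl, rfl⟩ := exists_eq_append_pair (ts := ts) (i := i)
        (by simp only at this; omega)
      simp only [joinAt_append]
      exact (isForest_join_iff ha (hq.full l (by simp)).1).2 hq
    · cases ts with
      | nil => simpa using hq.length_eq
      | cons l ts => exact (isForest_spine_iff ha).2 hq

/-! ### Enumeration of forests. -/

/-- The finite set of forests of `s` full trees and a spinal tree, labeled with
`j, j + 1, …, j + n - 1`. -/
def forests : ℕ → ℕ → ℕ → Finset (List (BinaryTree ℕ) × BinaryTree ℕ)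
  | 0, _, 0 => {([], nil)}
  | 0, _, _ + 1 => ∅
  | n + 1, j, s =>
    ((Finset.range s).biUnion fun i =>
      (forests n (j + 1) (s - 1)).image fun q => (insLeaf j i q.1, q.2)) ∪
    (((Finset.range s).biUnion fun i =>
      (forests n (j + 1) (s + 1)).image fun q => (joinAt j i q.1, q.2)) ∪
    (forests n (j + 1) (s + 1)).image (spineJoin j))

theorem mem_forests {n j s : ℕ} {p : List (BinaryTree ℕ) × BinaryTree ℕ} :
    p ∈ forests n j s ↔ IsForest (List.range' j n) s p := by
  induction n generalizing j s p with
  | zero =>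
    have hnil : ∀ t, projection t = [] → t = nil := by
      intro t ht
      cases t <;> simp_all [projection]
    obtain ⟨ts, u⟩ := p
    have hu : IsForest (List.range' j 0) s (ts, u) → u = nil := fun h => by
      have := h.perm
      simp [forestLabels] at this
      exact hnil u this.2
    rcases s with _ | s
    · simp only [forests, Finset.mem_singleton, Prod.mk.injEq]
      constructor
      · rintro ⟨rfl, rfl⟩
        exact ⟨rfl, by simp, trivial, trivial, by simp [forestLabels, projection]⟩
      · intro h
        exact ⟨List.length_eq_zero_iff.1 h.length_eq, hu h⟩
    · simp only [forests, Finset.notMem_empty, false_iff]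
      intro h
      cases ts with
      | nil => simpa using h.length_eq
      | cons t ts =>
        have := h.perm
        simp [forestLabels] at this
        exact (h.full t (by simp)).1 (hnil t this.1)
  | succ n ih =>
    rw [List.range'_succ, isForest_cons_iff (by simp; omega)]
    simp only [forests, Finset.mem_union, Finset.mem_biUnion, Finset.mem_range, Finset.mem_image,
      ih]

/-- The tree whose root is the new smallest label marks its own position. This makes the insertion
maps injective and their images disjoint. -/
theorem append_cons_inj_of_rootLabel {j : ℕ} {x x' : BinaryTree ℕ}
    {pre post pre' post' : List (BinaryTree ℕ)} (hx : rootLabel x = some j)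
    (hx' : rootLabel x' = some j) (hpre : ∀ t ∈ pre, rootLabel t ≠ some j)
    (hpre' : ∀ t ∈ pre', rootLabel t ≠ some j) (h : pre ++ x :: post = pre' ++ x' :: post') :
    pre = pre' ∧ x = x' ∧ post = post' := by
  induction pre generalizing pre' with
  | nil =>
    cases pre' with
    | nil => simpa using h
    | cons t pre' =>
      simp only [List.nil_append, List.cons_append, List.cons.injEq] at h
      exact absurd (h.1 ▸ hx) (hpre' t (by simp))
  | cons t pre ih =>
    cases pre' with
    | nil =>
      simp only [List.nil_append, List.cons_append, List.cons.injEq] at h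
      exact absurd (h.1 ▸ hx') (hpre t (by simp))
    | cons t' pre' =>
      simp only [List.cons_append, List.cons.injEq] at h
      obtain ⟨h1, h2⟩ := ih (fun t ht => hpre t (by simp [ht]))
        (fun t ht => hpre' t (by simp [ht])) h.2
      exact ⟨by rw [h.1, h1], h2⟩

theorem mem_range_of_mem_forests {n j s : ℕ} {p : List (BinaryTree ℕ) × BinaryTree ℕ}
    (hp : p ∈ forests n j s) {x : ℕ} (hx : x ∈ forestLabels p) : j ≤ x ∧ x < j + n := by
  simpa using (mem_forests.1 hp).perm.mem_iff.1 hx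

theorem length_of_mem_forests {n j s : ℕ} {p : List (BinaryTree ℕ) × BinaryTree ℕ}
    (hp : p ∈ forests n j s) : p.1.length = s := (mem_forests.1 hp).length_eq

theorem mem_range_of_mem_fst {n j s : ℕ} {p : List (BinaryTree ℕ) × BinaryTree ℕ}
    (hp : p ∈ forests n j s) {t : BinaryTree ℕ} (ht : t ∈ p.1) {x : ℕ} (hx : x ∈ projection t) :
    j ≤ x ∧ x < j + n :=
  mem_range_of_mem_forests hp (by
    simp only [forestLabels, List.mem_append, List.mem_flatMap]
    exact Or.inl ⟨t, ht, hx⟩)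

theorem mem_range_of_mem_snd {n j s : ℕ} {p : List (BinaryTree ℕ) × BinaryTree ℕ}
    (hp : p ∈ forests n j s) {x : ℕ} (hx : x ∈ projection p.2) : j ≤ x ∧ x < j + n :=
  mem_range_of_mem_forests hp (by
    simp only [forestLabels, List.mem_append]
    exact Or.inr hx)

theorem rootLabel_fst_ne {n j s : ℕ} {p : List (BinaryTree ℕ) × BinaryTree ℕ}
    (hp : p ∈ forests n (j + 1) s) {t : BinaryTree ℕ} (ht : t ∈ p.1) : rootLabel t ≠ some j :=
  fun h => by
    have := (mem_range_of_mem_fst hp ht (rootLabel_mem_projection h)).1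
    omega

theorem rootLabel_snd_ne {n j s : ℕ} {p : List (BinaryTree ℕ) × BinaryTree ℕ}
    (hp : p ∈ forests n (j + 1) s) : rootLabel p.2 ≠ some j :=
  fun h => by
    have := (mem_range_of_mem_snd hp (rootLabel_mem_projection h)).1
    omega

/-- Classification of the forests by the tree whose root has the smallest label. -/
theorem sum_forests_succ (n j s : ℕ) (g : List (BinaryTree ℕ) × BinaryTree ℕ → ℕ) :
    ∑ p ∈ forests (n + 1) j s, g p =
      ∑ i ∈ Finset.range s, ∑ q ∈ forests n (j + 1) (s - 1), g (insLeaf j i q.1, q.2) +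
      ∑ i ∈ Finset.range s, ∑ q ∈ forests n (j + 1) (s + 1), g (joinAt j i q.1, q.2) +
      ∑ q ∈ forests n (j + 1) (s + 1), g (spineJoin j q) := by
  have hleaf : ∀ i < s, ∀ q ∈ forests n (j + 1) (s - 1), ∃ pre post, q.1 = pre ++ post ∧
      pre.length = i ∧ insLeaf j i q.1 = pre ++ node j nil nil :: post ∧
      ∀ t ∈ pre, rootLabel t ≠ some j := by
    intro i hi q hq
    obtain ⟨pre, post, h1, rfl⟩ := exists_eq_append (ts := q.1) (i := i)
      (by rw [length_of_mem_forests hq]; omega)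
    exact ⟨pre, post, h1, rfl, by rw [h1, insLeaf_append],
      fun t ht => rootLabel_fst_ne hq (by simp [h1, ht])⟩
  have hjoin : ∀ i < s, ∀ q ∈ forests n (j + 1) (s + 1), ∃ pre l r post,
      q.1 = pre ++ l :: r :: post ∧ l ≠ nil ∧
      pre.length = i ∧ joinAt j i q.1 = pre ++ node j l r :: post ∧
      ∀ t ∈ pre, rootLabel t ≠ some j := by
    intro i hi q hq
    obtain ⟨pre, l, r, post, h1, rfl⟩ := exists_eq_append_pair (ts := q.1) (i := i)
      (by rw [length_of_mem_forests hq]; omega)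
    exact ⟨pre, l, r, post, h1, ((mem_forests.1 hq).full l (by simp [h1])).1, rfl,
      by rw [h1, joinAt_append], fun t ht => rootLabel_fst_ne hq (by simp [h1, ht])⟩
  rw [forests, Finset.sum_union, Finset.sum_union, Finset.sum_biUnion, Finset.sum_biUnion,
    add_assoc]
  · congr 1
    · refine Finset.sum_congr rfl fun i hi => Finset.sum_image fun q hq q' hq' h => ?_
      rw [Finset.mem_range] at hi
      obtain ⟨pre, post, h1, h2, h3, h4⟩ := hleaf i hi q hq
      obtain ⟨pre', post', h1', h2', h3', h4'⟩ := hleaf i hi q' hq'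
      simp only [Prod.mk.injEq, h3, h3'] at h
      obtain ⟨rfl, -, rfl⟩ := append_cons_inj_of_rootLabel rfl rfl h4 h4' h.1
      exact Prod.ext (h1.trans h1'.symm) h.2
    · congr 1
      · refine Finset.sum_congr rfl fun i hi => Finset.sum_image fun q hq q' hq' h => ?_
        rw [Finset.mem_range] at hi
        obtain ⟨pre, l, r, post, h1, h0, h2, h3, h4⟩ := hjoin i hi q hq
        obtain ⟨pre', l', r', post', h1', h0', h2', h3', h4'⟩ := hjoin i hi q' hq'
        simp only [Prod.mk.injEq, h3, h3'] at h
        obtain ⟨rfl, h5, rfl⟩ := append_cons_inj_of_rootLabel rfl rfl h4 h4' h.1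
        simp only [node.injEq, true_and] at h5
        obtain ⟨rfl, rfl⟩ := h5
        exact Prod.ext (h1.trans h1'.symm) h.2
      · refine Finset.sum_image fun q hq q' hq' h => ?_
        obtain ⟨ts, u⟩ := q
        obtain ⟨ts', u'⟩ := q'
        have e := length_of_mem_forests hq
        have e' := length_of_mem_forests hq'
        cases ts with
        | nil => simp at e
        | cons t ts =>
          cases ts' with
          | nil => simp at e'
          | cons t' ts' =>
            simp only [spineJoin, List.tail_cons, List.headD_cons, Prod.mk.injEq,
              node.injEq, true_and] at h
            obtain ⟨rfl, rfl, rfl⟩ := h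
            rfl
  · intro i hi i' hi' hne
    rw [Function.onFun, Finset.disjoint_left]
    simp only [Finset.coe_range, Set.mem_Iio] at hi hi'
    intro p hp hp'
    rw [Finset.mem_image] at hp hp'
    obtain ⟨q, hq, rfl⟩ := hp
    obtain ⟨q', hq', h⟩ := hp'
    obtain ⟨pre, l, r, post, h1, h0, h2, h3, h4⟩ := hjoin i hi q hq
    obtain ⟨pre', l', r', post', h1', h0', h2', h3', h4'⟩ := hjoin i' hi' q' hq'
    simp only [Prod.mk.injEq, h3, h3'] at h
    obtain ⟨rfl, -⟩ := append_cons_inj_of_rootLabel rfl rfl h4' h4 h.1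
    exact hne (h2.symm.trans h2')
  · intro i hi i' hi' hne
    rw [Function.onFun, Finset.disjoint_left]
    simp only [Finset.coe_range, Set.mem_Iio] at hi hi'
    intro p hp hp'
    rw [Finset.mem_image] at hp hp'
    obtain ⟨q, hq, rfl⟩ := hp
    obtain ⟨q', hq', h⟩ := hp'
    obtain ⟨pre, post, h1, h2, h3, h4⟩ := hleaf i hi q hq
    obtain ⟨pre', post', h1', h2', h3', h4'⟩ := hleaf i' hi' q' hq'
    simp only [Prod.mk.injEq, h3, h3'] at h
    obtain ⟨rfl, -⟩ := append_cons_inj_of_rootLabel rfl rfl h4' h4 h.1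
    exact hne (h2.symm.trans h2')
  · rw [Finset.disjoint_left]
    intro p hp hp'
    simp only [Finset.mem_biUnion, Finset.mem_range, Finset.mem_image] at hp hp'
    obtain ⟨i, hi, q, hq, rfl⟩ := hp
    obtain ⟨q', hq', h⟩ := hp'
    exact rootLabel_snd_ne hq (by rw [← (Prod.ext_iff.1 h).2]; rfl)
  · rw [Finset.disjoint_left]
    intro p hp hp'
    simp only [Finset.mem_biUnion, Finset.mem_range, Finset.mem_image, Finset.mem_union] at hp hp'
    obtain ⟨i, hi, q, hq, rfl⟩ := hp
    rcases hp' with ⟨i', hi', q', hq', h⟩ | ⟨q', hq', h⟩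
    · obtain ⟨pre, post, h1, h2, h3, h4⟩ := hleaf i hi q hq
      obtain ⟨pre', l', r', post', h1', h0', h2', h3', h4'⟩ := hjoin i' hi' q' hq'
      simp only [Prod.mk.injEq, h3, h3'] at h
      obtain ⟨-, h5, -⟩ := append_cons_inj_of_rootLabel rfl rfl h4' h4 h.1
      simp only [node.injEq, true_and] at h5
      exact h0' h5.1
    · exact rootLabel_snd_ne hq (by rw [← (Prod.ext_iff.1 h).2]; rfl)

theorem card_forests (n j s : ℕ) : (forests n j s).card = pathCount n s := by
  induction n generalizing j s with
  | zero => cases s <;> simp [forests, pathCount]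
  | succ n ih =>
    have h := sum_forests_succ n j s fun _ => 1
    simp only [Finset.sum_const, smul_eq_mul, mul_one, Finset.card_range, ih] at h
    rw [h, pathCount]
    ring

/-! ### The parent of the largest label. -/

/-- The node labeled `k` has a child labeled `x`. -/
def HasParent (k x : ℕ) : BinaryTree ℕ → Prop
  | nil => False
  | node a l r => (a = k ∧ (rootLabel l = some x ∨ rootLabel r = some x)) ∨
      HasParent k x l ∨ HasParent k x r

theorem HasParent.mem_projection {k x : ℕ} {t : BinaryTree ℕ} (h : HasParent k x t) :
    k ∈ projection t := by
  induction t with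
  | nil => exact h.elim
  | node a l r ihl ihr =>
    simp only [projection, List.mem_append, List.mem_cons]
    rcases h with ⟨rfl, -⟩ | h | h
    · simp
    · exact Or.inl (ihl h)
    · exact Or.inr (Or.inr (ihr h))

/-- The node labeled `k` of the forest `p` has a child labeled `x`. -/
def ForestHasParent (k x : ℕ) (p : List (BinaryTree ℕ) × BinaryTree ℕ) : Prop :=
  (∃ t ∈ p.1, HasParent k x t) ∨ HasParent k x p.2

theorem forestHasParent_leaf {k x a : ℕ} {pre post : List (BinaryTree ℕ)} {u : BinaryTree ℕ} :
    ForestHasParent k x (pre ++ node a nil nil :: post, u) ↔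
      ForestHasParent k x (pre ++ post, u) := by
  simp [ForestHasParent, HasParent, rootLabel, or_and_right, exists_or]

theorem forestHasParent_join {k x a : ℕ} {pre post : List (BinaryTree ℕ)} {l r u : BinaryTree ℕ} :
    ForestHasParent k x (pre ++ node a l r :: post, u) ↔
      (a = k ∧ (rootLabel l = some x ∨ rootLabel r = some x)) ∨
        ForestHasParent k x (pre ++ l :: r :: post, u) := by
  simp only [ForestHasParent, HasParent, List.mem_append, List.mem_cons, or_and_right, exists_or,
    exists_eq_left]
  grind

theorem forestHasParent_spine {k x a : ℕ} {ts : List (BinaryTree ℕ)} {l u : BinaryTree ℕ} :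
    ForestHasParent k x (ts, node a l u) ↔
      (a = k ∧ (rootLabel l = some x ∨ rootLabel u = some x)) ∨
        ForestHasParent k x (l :: ts, u) := by
  simp only [ForestHasParent, HasParent, List.mem_cons, or_and_right, exists_or,
    exists_eq_left]
  grind

theorem not_forestHasParent {n j s x : ℕ} {p : List (BinaryTree ℕ) × BinaryTree ℕ}
    (hp : p ∈ forests n (j + 1) s) : ¬ ForestHasParent j x p := by
  rintro (⟨t, ht, h⟩ | h)
  · have := (mem_range_of_mem_fst hp ht h.mem_projection).1
    omega
  · have := (mem_range_of_mem_snd hp h.mem_projection).1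
    omega

theorem IsForest.of_perm {ls ls' : List ℕ} {s : ℕ} {p : List (BinaryTree ℕ) × BinaryTree ℕ}
    (h : IsForest ls s p) (hl : ls.Perm ls') : IsForest ls' s p :=
  ⟨h.length_eq, h.full, h.spinal, h.increasing, h.perm.trans hl⟩

-- A root carrying the largest label has no children, so it is a one-node tree that can be deleted
-- from position `i` and reinserted there freely.
open Classical in
theorem card_max_leaf_at (n j s i : ℕ) (hi : i ≤ s) :
    ((forests (n + 1) j (s + 1)).filter
      fun p => (p.1[i]?).bind rootLabel = some (j + n)).card = pathCount n s := by
  have hperm : (List.range' j (n + 1)).Perm ((j + n) :: List.range' j n) := by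
    rw [List.range'_concat, one_mul]
    exact List.perm_append_singleton _ _
  have himage : (forests (n + 1) j (s + 1)).filter
      (fun p => (p.1[i]?).bind rootLabel = some (j + n)) =
      (forests n j s).image fun q => (insLeaf (j + n) i q.1, q.2) := by
    ext p
    simp only [Finset.mem_filter, Finset.mem_image]
    constructor
    · rintro ⟨hp, hroot⟩
      obtain ⟨ts, u⟩ := p
      obtain ⟨pre, post, h1, rfl⟩ := exists_eq_append (ts := ts) (i := i)
        (by have := length_of_mem_forests hp; simp only at this; omega)
      cases post with
      | nil =>
        have := length_of_mem_forests hp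
        simp [h1] at this
        omega
      | cons t post =>
        subst h1
        cases t with
        | nil => simp [rootLabel] at hroot
        | node a l r =>
          simp [rootLabel] at hroot
          subst hroot
          obtain ⟨-, -, hl, hr, -, -⟩ := (mem_forests.1 hp).full (node (j + n) l r) (by simp)
          have hnil : ∀ c, (∀ b ∈ rootLabel c, j + n < b) →
              (∀ b ∈ projection c, b ∈ projection (node (j + n) l r)) → c = nil := by
            intro c h1 h2
            cases c with
            | nil => rfl
            | node b c1 c2 =>
              have h3 := h1 b rfl
              have h4 := mem_range_of_mem_fst hp (t := node (j + n) l r) (by simp)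
                (h2 b (by simp [projection]))
              omega
          obtain rfl := hnil l hl (fun b hb => by simp [projection, hb])
          obtain rfl := hnil r hr (fun b hb => by simp [projection, hb])
          exact ⟨(pre ++ post, u), mem_forests.2 (isForest_leaf_iff.1
            ((mem_forests.1 hp).of_perm hperm)), by simp [insLeaf_append]⟩
    · rintro ⟨⟨ts, u⟩, hq, rfl⟩
      obtain ⟨pre, post, rfl, rfl⟩ := exists_eq_append (ts := ts) (i := i)
        (by have := length_of_mem_forests hq; simp only at this; omega)
      simp only [insLeaf_append]
      exact ⟨mem_forests.2 ((isForest_leaf_iff.2 (mem_forests.1 hq)).of_perm hperm.symm),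
        by simp [rootLabel]⟩
  rw [himage, Finset.card_image_of_injOn, card_forests]
  rintro ⟨ts, u⟩ hq ⟨ts', u'⟩ hq' h
  have e := length_of_mem_forests hq
  have e' := length_of_mem_forests hq'
  simp only at e e'
  obtain ⟨pre, post, rfl, rfl⟩ := exists_eq_append (ts := ts) (i := i) (by omega)
  obtain ⟨pre', post', rfl, h2⟩ := exists_eq_append (ts := ts') (i := pre.length) (by omega)
  simp only [insLeaf_append, Prod.mk.injEq] at h
  rw [← h2, insLeaf_append] at h
  obtain ⟨h3, h4⟩ := List.append_inj h.1 h2.symm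
  simp only [List.cons.injEq, true_and] at h4
  rw [h3, h4, h.2]

-- If the deleted node is the parent, the largest label becomes a one-node tree just exposed: either
-- child for each of the `s` full trees, only the left child for the spinal one, hence `2 s + 1`.
-- Earlier deletions follow the ordinary path rule.
open Classical in
theorem card_forestHasParent (d n j s : ℕ) :
    ((forests (n + d + 2) j s).filter (ForestHasParent (j + d) (j + n + d + 1))).card =
      pomCount (n + d + 2) d s := by
  induction d generalizing j s with
  | zero =>
    rw [Finset.card_filter, sum_forests_succ]
    simp only [Nat.add_zero]
    have h1 : ∀ i ∈ Finset.range s, ∑ q ∈ forests (n + 1) (j + 1) (s - 1),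
        (if ForestHasParent j (j + n + 1) (insLeaf j i q.1, q.2) then 1 else 0) = 0 := by
      intro i hi
      rw [Finset.mem_range] at hi
      refine Finset.sum_eq_zero fun q hq => if_neg ?_
      obtain ⟨ts, u⟩ := q
      obtain ⟨pre, post, rfl, rfl⟩ := exists_eq_append (ts := ts) (i := i)
        (by have := length_of_mem_forests hq; simp only at this; omega)
      rw [insLeaf_append, forestHasParent_leaf]
      exact not_forestHasParent hq
    have h2 : ∀ i ∈ Finset.range s, ∑ q ∈ forests (n + 1) (j + 1) (s + 1),
        (if ForestHasParent j (j + n + 1) (joinAt j i q.1, q.2) then 1 else 0) =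
          2 * pathCount n s := by
      intro i hi
      rw [Finset.mem_range] at hi
      have e1 := card_max_leaf_at n (j + 1) s i (by omega)
      have e2 := card_max_leaf_at n (j + 1) s (i + 1) (by omega)
      rw [Finset.card_filter] at e1 e2
      rw [two_mul]
      nth_rw 1 [← e1]
      rw [← e2, ← Finset.sum_add_distrib]
      refine Finset.sum_congr rfl fun q hq => ?_
      obtain ⟨ts, u⟩ := q
      obtain ⟨pre, l, r, post, rfl, rfl⟩ := exists_eq_append_pair (ts := ts) (i := i)
        (by have := length_of_mem_forests hq; simp only at this; omega)
      rw [joinAt_append, forestHasParent_join]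
      have hnp := not_forestHasParent (x := j + n + 1) hq
      -- The two events are exclusive, so the indicator of their union is the sum of the indicators.
      have hne : ¬ (rootLabel l = some (j + n + 1) ∧ rootLabel r = some (j + n + 1)) := by
        rintro ⟨hl, hr⟩
        have hnd : (forestLabels (pre ++ l :: r :: post, u)).Nodup :=
          (mem_forests.1 hq).perm.nodup_iff.2 List.nodup_range'
        have h3 := List.nodup_iff_count_le_one.1 hnd (j + n + 1)
        have h4 := List.count_pos_iff.2 (rootLabel_mem_projection hl)
        have h5 := List.count_pos_iff.2 (rootLabel_mem_projection hr)
        simp only [forestLabels, List.flatMap_append, List.flatMap_cons, List.count_append] at h3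
        omega
      have e3 : j + 1 + n = j + n + 1 := by omega
      by_cases hl : rootLabel l = some (j + n + 1) <;>
        by_cases hr : rootLabel r = some (j + n + 1) <;>
        simp_all
    have h3 : ∑ q ∈ forests (n + 1) (j + 1) (s + 1),
        (if ForestHasParent j (j + n + 1) (spineJoin j q) then 1 else 0) = pathCount n s := by
      have e1 := card_max_leaf_at n (j + 1) s 0 (by omega)
      rw [Finset.card_filter] at e1
      rw [← e1]
      refine Finset.sum_congr rfl fun q hq => ?_
      obtain ⟨ts, u⟩ := q
      cases ts with
      | nil => simpa using length_of_mem_forests hq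
      | cons l ts =>
        have hnp := not_forestHasParent (x := j + n + 1) hq
        -- A spinal root has a left child with a larger label, so it cannot be the maximum.
        have hu : rootLabel u ≠ some (j + n + 1) := by
          intro hu
          cases u with
          | nil => simp [rootLabel] at hu
          | node b c u =>
            simp only [rootLabel, Option.some.injEq] at hu
            subst hu
            have hs := (mem_forests.1 hq).spinal
            have hinc := (mem_forests.1 hq).increasing
            cases c with
            | nil => exact hs.1 rfl
            | node b c1 c2 =>
              have h4 := hinc.1 b rfl
              have h5 := mem_range_of_mem_snd hq (x := b) (by simp [projection])
              omega
        have e3 : j + 1 + n = j + n + 1 := by omega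
        rw [spineJoin_cons, forestHasParent_spine]
        simp [hnp, hu, e3]
    rw [Finset.sum_congr rfl h1, Finset.sum_congr rfl h2, h3]
    simp [pomCount]
    ring
  | succ d ih =>
    have e : ∀ s, ∑ q ∈ forests (n + d + 2) (j + 1) s,
        (if ForestHasParent (j + (d + 1)) (j + n + (d + 1) + 1) q then 1 else 0) =
          pomCount (n + d + 2) d s := by
      intro s
      rw [← ih (j + 1) s, Finset.card_filter, show j + 1 + d = j + (d + 1) by ring,
        show j + 1 + n + d + 1 = j + n + (d + 1) + 1 by ring]
    rw [Finset.card_filter, show n + (d + 1) + 2 = (n + d + 2) + 1 by ring, sum_forests_succ]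
    have h1 : ∀ i ∈ Finset.range s, ∑ q ∈ forests (n + d + 2) (j + 1) (s - 1),
        (if ForestHasParent (j + (d + 1)) (j + n + (d + 1) + 1) (insLeaf j i q.1, q.2)
          then 1 else 0) = pomCount (n + d + 2) d (s - 1) := by
      intro i hi
      rw [Finset.mem_range] at hi
      rw [← e]
      refine Finset.sum_congr rfl fun q hq => ?_
      obtain ⟨ts, u⟩ := q
      obtain ⟨pre, post, rfl, rfl⟩ := exists_eq_append (ts := ts) (i := i)
        (by have := length_of_mem_forests hq; simp only at this; omega)
      rw [insLeaf_append, forestHasParent_leaf]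
    have h2 : ∀ i ∈ Finset.range s, ∑ q ∈ forests (n + d + 2) (j + 1) (s + 1),
        (if ForestHasParent (j + (d + 1)) (j + n + (d + 1) + 1) (joinAt j i q.1, q.2)
          then 1 else 0) = pomCount (n + d + 2) d (s + 1) := by
      intro i hi
      rw [Finset.mem_range] at hi
      rw [← e]
      refine Finset.sum_congr rfl fun q hq => ?_
      obtain ⟨ts, u⟩ := q
      obtain ⟨pre, l, r, post, rfl, rfl⟩ := exists_eq_append_pair (ts := ts) (i := i)
        (by have := length_of_mem_forests hq; simp only at this; omega)
      rw [joinAt_append, forestHasParent_join]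
      simp
    have h3 : ∑ q ∈ forests (n + d + 2) (j + 1) (s + 1),
        (if ForestHasParent (j + (d + 1)) (j + n + (d + 1) + 1) (spineJoin j q)
          then 1 else 0) = pomCount (n + d + 2) d (s + 1) := by
      rw [← e]
      refine Finset.sum_congr rfl fun q hq => ?_
      obtain ⟨ts, u⟩ := q
      cases ts with
      | nil => simpa using length_of_mem_forests hq
      | cons l ts =>
        rw [spineJoin_cons, forestHasParent_spine]
        simp
    rw [Finset.sum_congr rfl h1, Finset.sum_congr rfl h2, h3, pomCount_succ_succ]
    simp
    ring

/-! ### The end of the minimal chain. -/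

theorem mem_projection_of_eoc {t : BinaryTree ℕ} {m : ℕ} (h : eoc t = some m) :
    m ∈ projection t := by
  induction t with
  | nil => simp [eoc] at h
  | node a l r ihl ihr =>
    simp only [projection, List.mem_append, List.mem_cons]
    cases l with
    | nil =>
      cases r with
      | nil => simp [eoc, rootLabel] at h; simp [h]
      | node c r1 r2 => exact Or.inr (Or.inr (ihr h))
    | node b l1 l2 =>
      cases r with
      | nil => exact Or.inl (ihl h)
      | node c r1 r2 =>
        rw [eoc] at h
        simp only [rootLabel] at h
        split_ifs at h
        · exact Or.inl (ihl h)
        · exact Or.inr (Or.inr (ihr h))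

/-- This justifies the dummy root label `0` in `PairEnds` and `SpineEnds`. -/
theorem eoc_node_of_ne_nil {a b : ℕ} {l r : BinaryTree ℕ} (hl : l ≠ nil) :
    eoc (node a l r) = eoc (node b l r) := by
  cases l with
  | nil => exact absurd rfl hl
  | node c l1 l2 => cases r <;> simp [eoc, rootLabel]

theorem eoc_node_left {a j : ℕ} {l r u : BinaryTree ℕ} (hu : ∀ b ∈ rootLabel u, j < b) :
    eoc (node a (node j l r) u) = eoc (node j l r) := by
  cases u with
  | nil => conv_lhs => rw [eoc]; simp only [rootLabel]
  | node c u1 u2 =>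
    conv_lhs => rw [eoc]; simp only [rootLabel]
    rw [if_pos (hu c rfl)]

theorem eoc_node_right {a j : ℕ} {l r u : BinaryTree ℕ} (hu : ∀ b ∈ rootLabel u, j < b) :
    eoc (node a u (node j l r)) = eoc (node j l r) := by
  cases u with
  | nil => conv_lhs => rw [eoc]; simp only [rootLabel]
  | node c u1 u2 =>
    conv_lhs => rw [eoc]; simp only [rootLabel]
    rw [if_neg (hu c rfl).not_gt]

/-- The minimal chain of the tree formed by the first two trees of the list ends in `m`. -/
def PairEnds (m : ℕ) : List (BinaryTree ℕ) → Prop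
  | c :: d :: _ => eoc (node 0 c d) = some m
  | _ => False

/-- The minimal chain of the tree formed by the first tree of the forest and the spinal tree ends
in `m`. -/
def SpineEnds (m : ℕ) : List (BinaryTree ℕ) × BinaryTree ℕ → Prop
  | (c :: _, u) => eoc (node 0 c u) = some m
  | ([], _) => False

theorem lt_rootLabel_fst {n j s : ℕ} {p : List (BinaryTree ℕ) × BinaryTree ℕ}
    (hp : p ∈ forests n (j + 1) s) {t : BinaryTree ℕ} (ht : t ∈ p.1) :
    ∀ b ∈ rootLabel t, j < b := fun _ hb =>
  (mem_range_of_mem_fst hp ht (rootLabel_mem_projection hb)).1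

theorem lt_rootLabel_snd {n j s : ℕ} {p : List (BinaryTree ℕ) × BinaryTree ℕ}
    (hp : p ∈ forests n (j + 1) s) : ∀ b ∈ rootLabel p.2, j < b := fun _ hb =>
  (mem_range_of_mem_snd hp (rootLabel_mem_projection hb)).1

theorem ne_nil_of_mem_forests {n j s : ℕ} {p : List (BinaryTree ℕ) × BinaryTree ℕ}
    (hp : p ∈ forests n j s) {t : BinaryTree ℕ} (ht : t ∈ p.1) : t ≠ nil :=
  ((mem_forests.1 hp).full t ht).1

/-- Forest conditions ignore the order of the full trees, so the tracked pair may be moved to the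
front without changing a count. -/
theorem sum_forests_perm (e : Equiv.Perm (List (BinaryTree ℕ))) (he : ∀ l, (e l).Perm l)
    (n j s : ℕ) (g : List (BinaryTree ℕ) × BinaryTree ℕ → ℕ) :
    ∑ q ∈ forests n j s, g (e q.1, q.2) = ∑ q ∈ forests n j s, g q := by
  have key : ∀ (l l' : List (BinaryTree ℕ)) (u : BinaryTree ℕ), l'.Perm l →
      (l, u) ∈ forests n j s → (l', u) ∈ forests n j s := by
    intro l l' u hl h
    rw [mem_forests] at h ⊢
    exact ⟨hl.length_eq.trans h.length_eq, fun t ht => h.full t (hl.mem_iff.1 ht), h.spinal,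
      h.increasing, ((hl.flatMap_right projection).append_right _).trans h.perm⟩
  refine Finset.sum_equiv (e.prodCongr (Equiv.refl _)) (fun q => ?_) (fun q _ => rfl)
  exact ⟨fun h => key q.1 (e q.1) q.2 (he _) h, fun h => key (e q.1) q.1 q.2 (he _).symm h⟩

/-- Exchange the first two entries of a list. -/
def swapHead {α : Type*} : List α → List α
  | a :: b :: l => b :: a :: l
  | l => l

theorem swapHead_involutive {α : Type*} : Function.Involutive (swapHead (α := α)) := by
  rintro (_ | ⟨a, _ | ⟨b, l⟩⟩) <;> rfl

theorem swapHead_perm {α : Type*} : ∀ l : List α, (swapHead l).Perm l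
  | [] => List.Perm.refl _
  | [_] => List.Perm.refl _
  | a :: b :: l => List.Perm.swap a b l

/-- Exchange the second and the third entry of a list. -/
def swapSecond {α : Type*} : List α → List α
  | a :: l => a :: swapHead l
  | [] => []

theorem swapSecond_involutive {α : Type*} : Function.Involutive (swapSecond (α := α)) := by
  rintro (_ | ⟨a, l⟩)
  · rfl
  · simp [swapSecond, swapHead_involutive l]

theorem swapSecond_perm {α : Type*} : ∀ l : List α, (swapSecond l).Perm l
  | [] => List.Perm.refl _
  | _ :: l => (swapHead_perm l).cons _

/-- Move the first entry of a list to the third position. -/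
def rotateThree {α : Type*} : Equiv.Perm (List α) :=
  swapHead_involutive.toPerm.trans swapSecond_involutive.toPerm

theorem rotateThree_perm {α : Type*} (l : List α) : (rotateThree l).Perm l :=
  (swapSecond_perm _).trans (swapHead_perm l)

theorem rotateThree_cons {α : Type*} (a b c : α) (l : List α) :
    rotateThree (a :: b :: c :: l) = b :: c :: a :: l := rfl

theorem pairEnds_leaf {j m n s : ℕ} {ts : List (BinaryTree ℕ)} {u : BinaryTree ℕ}
    (h : (ts, u) ∈ forests n (j + 1) (s + 1)) :
    (PairEnds m (insLeaf j 0 ts) ↔ m = j) ∧ (PairEnds m (insLeaf j 1 ts) ↔ m = j) := by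
  cases ts with
  | nil => simpa using length_of_mem_forests h
  | cons d ts =>
    have hd := lt_rootLabel_fst h (t := d) (by simp)
    simp only [insLeaf, PairEnds, eoc_node_left hd, eoc_node_right hd]
    simp [eoc, rootLabel, eq_comm]

theorem pairEnds_join_zero {j m n s : ℕ} {ts : List (BinaryTree ℕ)} {u : BinaryTree ℕ}
    (h : (ts, u) ∈ forests n (j + 1) (s + 3)) :
    PairEnds m (joinAt j 0 ts) ↔ PairEnds m ts := by
  match ts, length_of_mem_forests h with
  | l :: r :: d :: ts, _ =>
    have hd := lt_rootLabel_fst h (t := d) (by simp)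
    have hl := ne_nil_of_mem_forests h (t := l) (by simp)
    simp only [joinAt, PairEnds, eoc_node_left hd, eoc_node_of_ne_nil (a := j) (b := 0) hl]

/-- The chain enters the second tracked tree, whose subtrees `l`, `r` become the new pair; the
rotation moves the abandoned `c` behind them. -/
theorem pairEnds_join_one {j m n s : ℕ} {ts : List (BinaryTree ℕ)} {u : BinaryTree ℕ}
    (h : (ts, u) ∈ forests n (j + 1) (s + 3)) :
    PairEnds m (joinAt j 1 ts) ↔ PairEnds m (rotateThree ts) := by
  match ts, length_of_mem_forests h with
  | c :: l :: r :: ts, _ =>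
    have hc := lt_rootLabel_fst h (t := c) (by simp)
    have hl := ne_nil_of_mem_forests h (t := l) (by simp)
    simp only [joinAt, rotateThree_cons, PairEnds, eoc_node_right hc,
      eoc_node_of_ne_nil (a := j) (b := 0) hl]

/-- The tracked pair is untouched, but the spine's left subtree now stands in front of it. -/
theorem pairEnds_spineJoin {j m n s : ℕ} {ts : List (BinaryTree ℕ)} {u : BinaryTree ℕ}
    (h : (ts, u) ∈ forests n (j + 1) (s + 3)) :
    PairEnds m (spineJoin j (ts, u)).1 ↔ PairEnds m (rotateThree ts) := by
  match ts, length_of_mem_forests h with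
  | c :: l :: r :: ts, _ => simp only [spineJoin_cons, rotateThree_cons, PairEnds]

theorem pairEnds_insLeaf_add_two {j m i : ℕ} {ts : List (BinaryTree ℕ)} (h : 2 ≤ ts.length) :
    PairEnds m (insLeaf j (i + 2) ts) ↔ PairEnds m ts := by
  match ts, h with
  | _ :: _ :: _, _ => rfl

theorem pairEnds_joinAt_add_two {j m i : ℕ} {ts : List (BinaryTree ℕ)} (h : 2 ≤ ts.length) :
    PairEnds m (joinAt j (i + 2) ts) ↔ PairEnds m ts := by
  match ts, h with
  | _ :: _ :: _, _ => rfl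

theorem spineEnds_leaf {j m n s : ℕ} {ts : List (BinaryTree ℕ)} {u : BinaryTree ℕ}
    (h : (ts, u) ∈ forests n (j + 1) s) : SpineEnds m (insLeaf j 0 ts, u) ↔ m = j := by
  have hu := lt_rootLabel_snd h
  simp only [insLeaf, SpineEnds, eoc_node_left hu]
  simp [eoc, rootLabel, eq_comm]

theorem spineEnds_join_zero {j m n s : ℕ} {ts : List (BinaryTree ℕ)} {u : BinaryTree ℕ}
    (h : (ts, u) ∈ forests n (j + 1) (s + 2)) :
    SpineEnds m (joinAt j 0 ts, u) ↔ PairEnds m ts := by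
  match ts, length_of_mem_forests h with
  | l :: r :: ts, _ =>
    have hu := lt_rootLabel_snd h
    have hl := ne_nil_of_mem_forests h (t := l) (by simp)
    simp only [joinAt, PairEnds, SpineEnds, eoc_node_left hu,
      eoc_node_of_ne_nil (a := j) (b := 0) hl]

/-- The spine root is the smaller child, so the chain enters it and next chooses between `l` and
`u`; the former first tree `c` becomes an ordinary one. -/
theorem spineEnds_spineJoin {j m n s : ℕ} {ts : List (BinaryTree ℕ)} {u : BinaryTree ℕ}
    (h : (ts, u) ∈ forests n (j + 1) (s + 2)) :
    SpineEnds m (spineJoin j (ts, u)) ↔ SpineEnds m (ts, u) := by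
  match ts, length_of_mem_forests h with
  | l :: c :: ts, _ =>
    have hc := lt_rootLabel_fst h (t := c) (by simp)
    have hl := ne_nil_of_mem_forests h (t := l) (by simp)
    simp only [spineJoin_cons, SpineEnds, eoc_node_right hc,
      eoc_node_of_ne_nil (a := j) (b := 0) hl]

theorem spineEnds_insLeaf_succ {j m i : ℕ} {ts : List (BinaryTree ℕ)} {u : BinaryTree ℕ}
    (h : 1 ≤ ts.length) : SpineEnds m (insLeaf j (i + 1) ts, u) ↔ SpineEnds m (ts, u) := by
  match ts, h with
  | _ :: _, _ => rfl

theorem spineEnds_joinAt_succ {j m i : ℕ} {ts : List (BinaryTree ℕ)} {u : BinaryTree ℕ}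
    (h : 1 ≤ ts.length) : SpineEnds m (joinAt j (i + 1) ts, u) ↔ SpineEnds m (ts, u) := by
  match ts, h with
  | _ :: _, _ => rfl

open Classical in
/-- The number of forests for which `PairEnds m` holds. -/
noncomputable def pairSum (m n j s : ℕ) : ℕ :=
  ∑ p ∈ forests n j s, if PairEnds m p.1 then 1 else 0

open Classical in
/-- The number of forests for which `SpineEnds m` holds. -/
noncomputable def spineSum (m n j s : ℕ) : ℕ :=
  ∑ p ∈ forests n j s, if SpineEnds m p then 1 else 0

theorem pairSum_eq_zero (m n s : ℕ) : pairSum m n (m + 1) s = 0 := by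
  refine Finset.sum_eq_zero fun p hp => if_neg fun h => ?_
  obtain ⟨ts, u⟩ := p
  match ts, h with
  | c :: d :: ts, h =>
    have h1 := mem_projection_of_eoc h
    simp only [projection, List.mem_append, List.mem_cons] at h1
    rcases h1 with h1 | h1 | h1
    · have := mem_range_of_mem_fst hp (t := c) (by simp) h1
      omega
    · have := mem_range_of_mem_fst hp (t := c) (by simp) (x := m)
      cases c with
      | nil => exact ne_nil_of_mem_forests hp (t := nil) (by simp) rfl
      | node b c1 c2 =>
        -- Relabeling the dummy root by `m + 1` handles `m = 0`, where the chain might seem to end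
        -- at the dummy itself.
        rw [PairEnds, eoc_node_of_ne_nil (a := 0) (b := m + 1) (by simp)] at h
        have h2 := mem_projection_of_eoc h
        simp only [projection, List.mem_append, List.mem_cons] at h2 this
        rcases h2 with h2 | h2 | h2
        · have := this h2
          omega
        · omega
        · have := mem_range_of_mem_fst hp (t := d) (by simp) h2
          omega
    · have := mem_range_of_mem_fst hp (t := d) (by simp) h1
      omega

theorem spineSum_eq_zero (m n s : ℕ) : spineSum m n (m + 1) s = 0 := by
  refine Finset.sum_eq_zero fun p hp => if_neg fun h => ?_
  obtain ⟨ts, u⟩ := p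
  match ts, h with
  | c :: ts, h =>
    have hc := ne_nil_of_mem_forests hp (t := c) (by simp)
    rw [SpineEnds, eoc_node_of_ne_nil (a := 0) (b := m + 1) hc] at h
    have h1 := mem_projection_of_eoc h
    simp only [projection, List.mem_append, List.mem_cons] at h1
    rcases h1 with h1 | h1 | h1
    · have := mem_range_of_mem_fst hp (t := c) (by simp) h1
      omega
    · omega
    · have := mem_range_of_mem_snd hp h1
      omega

/-- Either tracked tree may be a leaf, which ends the chain. Otherwise the weight `q + 3` collects
two splittings of tracked trees, `q` of other trees and one of the spine. -/
theorem pairSum_succ (m n j q : ℕ) : pairSum m (n + 1) j (q + 2) =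
    (if m = j then 2 * pathCount n (q + 1) else 0) + q * pairSum m n (j + 1) (q + 1) +
      (q + 3) * pairSum m n (j + 1) (q + 3) := by
  classical
  have hrot : ∑ p ∈ forests n (j + 1) (q + 3), (if PairEnds m (rotateThree p.1) then 1 else 0) =
      pairSum m n (j + 1) (q + 3) :=
    sum_forests_perm rotateThree rotateThree_perm n (j + 1) (q + 3)
      fun p => if PairEnds m p.1 then 1 else 0
  rw [pairSum, sum_forests_succ, Finset.sum_range_succ', Finset.sum_range_succ',
    Finset.sum_range_succ', Finset.sum_range_succ']
  simp only [show q + 2 - 1 = q + 1 from rfl, show q + 2 + 1 = q + 3 from rfl]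
  have l0 : ∑ p ∈ forests n (j + 1) (q + 1), (if PairEnds m (insLeaf j 0 p.1) then 1 else 0) =
      if m = j then pathCount n (q + 1) else 0 := by
    rw [Finset.sum_congr rfl fun p hp => by rw [(pairEnds_leaf (m := m) hp).1]]
    split_ifs <;> simp [card_forests]
  have l1 : ∑ p ∈ forests n (j + 1) (q + 1),
      (if PairEnds m (insLeaf j (0 + 1) p.1) then 1 else 0) =
      if m = j then pathCount n (q + 1) else 0 := by
    rw [Finset.sum_congr rfl fun p hp => by rw [zero_add, (pairEnds_leaf (m := m) hp).2]]
    split_ifs <;> simp [card_forests]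
  have l2 : ∀ i ∈ Finset.range q, ∑ p ∈ forests n (j + 1) (q + 1),
      (if PairEnds m (insLeaf j (i + 1 + 1) p.1) then 1 else 0) =
        pairSum m n (j + 1) (q + 1) := by
    intro i hi
    rw [Finset.mem_range] at hi
    refine Finset.sum_congr rfl fun p hp => ?_
    have := length_of_mem_forests hp
    rw [pairEnds_insLeaf_add_two (by omega)]
  have j0 : ∑ p ∈ forests n (j + 1) (q + 3), (if PairEnds m (joinAt j 0 p.1) then 1 else 0) =
      pairSum m n (j + 1) (q + 3) :=
    Finset.sum_congr rfl fun p hp => by rw [pairEnds_join_zero hp]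
  have j1 : ∑ p ∈ forests n (j + 1) (q + 3),
      (if PairEnds m (joinAt j (0 + 1) p.1) then 1 else 0) = pairSum m n (j + 1) (q + 3) := by
    rw [← hrot]
    exact Finset.sum_congr rfl fun p hp => by rw [zero_add, pairEnds_join_one hp]
  have j2 : ∀ i ∈ Finset.range q, ∑ p ∈ forests n (j + 1) (q + 3),
      (if PairEnds m (joinAt j (i + 1 + 1) p.1) then 1 else 0) =
        pairSum m n (j + 1) (q + 3) := by
    intro i hi
    refine Finset.sum_congr rfl fun p hp => ?_
    have := length_of_mem_forests hp
    rw [pairEnds_joinAt_add_two (by omega)]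
  have sp : ∑ p ∈ forests n (j + 1) (q + 3), (if PairEnds m (spineJoin j p).1 then 1 else 0) =
      pairSum m n (j + 1) (q + 3) := by
    rw [← hrot]
    exact Finset.sum_congr rfl fun p hp => by rw [pairEnds_spineJoin hp]
  rw [Finset.sum_congr rfl l2, Finset.sum_congr rfl j2, l0, l1, j0, j1, sp]
  simp only [Finset.sum_const, Finset.card_range, smul_eq_mul]
  split_ifs <;> ring

/-- Splitting the tracked full tree takes the chain off the spine, which gives the `pairSum` term;
splitting the spinal tree or one of the `q` others keeps the state. -/
theorem spineSum_succ (m n j q : ℕ) : spineSum m (n + 1) j (q + 1) =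
    (if m = j then pathCount n q else 0) + q * spineSum m n (j + 1) q +
      (q + 1) * spineSum m n (j + 1) (q + 2) + pairSum m n (j + 1) (q + 2) := by
  classical
  rw [spineSum, sum_forests_succ, Finset.sum_range_succ', Finset.sum_range_succ']
  simp only [show q + 1 - 1 = q from rfl, show q + 1 + 1 = q + 2 from rfl]
  have l0 : ∑ p ∈ forests n (j + 1) q, (if SpineEnds m (insLeaf j 0 p.1, p.2) then 1 else 0) =
      if m = j then pathCount n q else 0 := by
    rw [Finset.sum_congr rfl fun p hp => by rw [spineEnds_leaf (m := m) hp]]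
    split_ifs <;> simp [card_forests]
  have l1 : ∀ i ∈ Finset.range q, ∑ p ∈ forests n (j + 1) q,
      (if SpineEnds m (insLeaf j (i + 1) p.1, p.2) then 1 else 0) =
        spineSum m n (j + 1) q := by
    intro i hi
    rw [Finset.mem_range] at hi
    refine Finset.sum_congr rfl fun p hp => ?_
    have := length_of_mem_forests hp
    rw [spineEnds_insLeaf_succ (by omega)]
  have j0 : ∑ p ∈ forests n (j + 1) (q + 2),
      (if SpineEnds m (joinAt j 0 p.1, p.2) then 1 else 0) = pairSum m n (j + 1) (q + 2) :=
    Finset.sum_congr rfl fun p hp => by rw [spineEnds_join_zero hp]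
  have j1 : ∀ i ∈ Finset.range q, ∑ p ∈ forests n (j + 1) (q + 2),
      (if SpineEnds m (joinAt j (i + 1) p.1, p.2) then 1 else 0) =
        spineSum m n (j + 1) (q + 2) := by
    intro i hi
    refine Finset.sum_congr rfl fun p hp => ?_
    have := length_of_mem_forests hp
    rw [spineEnds_joinAt_succ (by omega)]
  have sp : ∑ p ∈ forests n (j + 1) (q + 2), (if SpineEnds m (spineJoin j p) then 1 else 0) =
      spineSum m n (j + 1) (q + 2) :=
    Finset.sum_congr rfl fun p hp => by rw [spineEnds_spineJoin hp]
  rw [Finset.sum_congr rfl l1, Finset.sum_congr rfl j1, l0, j0, sp]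
  simp only [Finset.sum_const, Finset.card_range, smul_eq_mul]
  ring

theorem pairSum_eq (d n j q : ℕ) :
    pairSum (j + d) n j (q + 2) = pairEocCount n d q := by
  induction n generalizing d j q with
  | zero => simp [pairSum, forests, pairEocCount]
  | succ n ih =>
    rw [pairSum_succ]
    cases d with
    | zero => simp [pairSum_eq_zero, pairEocCount]
    | succ d =>
      rw [if_neg (by omega), pairEocCount_succ_succ, show j + (d + 1) = j + 1 + d by ring, ih]
      cases q with
      | zero => simp
      | succ q => rw [ih]; simp

theorem spineSum_eq (d n j q : ℕ) :
    spineSum (j + d) n j (q + 1) = spineEocCount n d q := by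
  induction n generalizing d j q with
  | zero => simp [spineSum, forests, spineEocCount]
  | succ n ih =>
    rw [spineSum_succ]
    cases d with
    | zero => simp [pairSum_eq_zero, spineSum_eq_zero, spineEocCount]
    | succ d =>
      rw [if_neg (by omega), spineEocCount_succ_succ, show j + (d + 1) = j + 1 + d by ring, ih,
        pairSum_eq]
      cases q with
      | zero => simp
      | succ q => rw [ih]; simp

/-! ### From forests back to secant trees. -/

theorem length_projection (t : BinaryTree ℕ) : (projection t).length = t.numNodes := by
  induction t with
  | nil => rfl
  | node a l r ihl ihr => simp [projection, ihl, ihr]; omega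

theorem HasParent.child_mem {k x : ℕ} {t : BinaryTree ℕ} (h : HasParent k x t) :
    x ∈ projection t := by
  induction t with
  | nil => exact h.elim
  | node a l r ihl ihr =>
    simp only [projection, List.mem_append, List.mem_cons]
    rcases h with ⟨-, h | h⟩ | h | h
    · exact Or.inl (rootLabel_mem_projection h)
    · exact Or.inr (Or.inr (rootLabel_mem_projection h))
    · exact Or.inl (ihl h)
    · exact Or.inr (Or.inr (ihr h))

theorem HasParent.lt {k x : ℕ} {t : BinaryTree ℕ} (h : HasParent k x t) (ht : IsIncreasing t) :
    k < x := by
  induction t with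
  | nil => exact h.elim
  | node a l r ihl ihr =>
    obtain ⟨h1, h2, h3, h4⟩ := ht
    rcases h with ⟨rfl, h | h⟩ | h | h
    · exact h1 x h
    · exact h2 x h
    · exact ihl h h3
    · exact ihr h h4

theorem HasParent.rootLabel_ne {k x : ℕ} {t : BinaryTree ℕ} (h : HasParent k x t)
    (ht : IsIncreasing t) : rootLabel t ≠ some x := fun hx =>
  (h.lt ht).not_ge (le_of_mem_projection ht hx h.mem_projection)

theorem exists_hasParent {x : ℕ} {t : BinaryTree ℕ} (hx : x ∈ projection t)
    (hr : rootLabel t ≠ some x) : ∃ k, HasParent k x t := by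
  induction t with
  | nil => simp [projection] at hx
  | node a l r ihl ihr =>
    simp only [projection, List.mem_append, List.mem_cons] at hx
    rcases hx with hx | rfl | hx
    · by_cases h : rootLabel l = some x
      · exact ⟨a, Or.inl ⟨rfl, Or.inl h⟩⟩
      · obtain ⟨k, hk⟩ := ihl hx h
        exact ⟨k, Or.inr (Or.inl hk)⟩
    · exact absurd rfl hr
    · by_cases h : rootLabel r = some x
      · exact ⟨a, Or.inl ⟨rfl, Or.inr h⟩⟩
      · obtain ⟨k, hk⟩ := ihr hx h
        exact ⟨k, Or.inr (Or.inr hk)⟩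

theorem hasParent_of_parentOf {k x : ℕ} {t : BinaryTree ℕ} (h : parentOf x t = some k) :
    HasParent k x t := by
  induction t with
  | nil => simp [parentOf] at h
  | node a l r ihl ihr =>
    rw [parentOf] at h
    split_ifs at h with h1
    · exact Or.inl ⟨by simpa using h, h1⟩
    · rcases Option.or_eq_some_iff.1 h with h | ⟨-, h⟩
      · exact Or.inr (Or.inl (ihl h))
      · exact Or.inr (Or.inr (ihr h))

/-- Distinct labels make the parent unique, so the left-first search in `parentOf` cannot stop at a
wrong node. -/
theorem parentOf_eq_some_iff {k x : ℕ} {t : BinaryTree ℕ} (ht : IsIncreasing t)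
    (hn : (projection t).Nodup) : parentOf x t = some k ↔ HasParent k x t := by
  refine ⟨hasParent_of_parentOf, fun h => ?_⟩
  induction t with
  | nil => exact h.elim
  | node a l r ihl ihr =>
    obtain ⟨-, -, hil, hir⟩ := ht
    simp only [projection, List.nodup_append, List.nodup_cons, List.mem_cons] at hn
    obtain ⟨hnl, ⟨-, hnr⟩, hdis⟩ := hn
    rw [parentOf]
    rcases h with ⟨rfl, h⟩ | h | h
    · rw [if_pos h]
    · rw [if_neg, ihl hil hnl h]
      · rfl
      · rintro (h1 | h1)
        · exact h.rootLabel_ne hil h1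
        · exact hdis x h.child_mem x (Or.inr (rootLabel_mem_projection h1)) rfl
    · rw [if_neg, ihr hir hnr h]
      · cases hl : parentOf x l with
        | none => rfl
        | some k' =>
          exact absurd rfl (hdis x (hasParent_of_parentOf hl).child_mem x (Or.inr h.child_mem))
      · rintro (h1 | h1)
        · exact hdis x (rootLabel_mem_projection h1) x (Or.inr h.child_mem) rfl
        · exact h.rootLabel_ne hir h1

theorem exists_eoc {t : BinaryTree ℕ} (ht : t ≠ nil) : ∃ m, eoc t = some m := by
  induction t with
  | nil => exact absurd rfl ht
  | node a l r ihl ihr =>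
    cases l with
    | nil =>
      cases r with
      | nil => exact ⟨a, rfl⟩
      | node c r1 r2 => exact ihr (by simp)
    | node b l1 l2 =>
      cases r with
      | nil => exact ihl (by simp)
      | node c r1 r2 =>
        rw [eoc]
        simp only [rootLabel]
        split_ifs
        · exact ihl (by simp)
        · exact ihr (by simp)

theorem mem_completeIncreasingTrees_iff {n : ℕ} (hn : Even n) (h0 : n ≠ 0) (t : BinaryTree ℕ) :
    t ∈ completeIncreasingTrees n ↔ ([], t) ∈ forests n 1 0 := by
  rw [mem_forests, completeIncreasingTrees, Set.mem_ofPred_eq, isCompleteShape_iff hn]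
  constructor
  · rintro ⟨h1, -, h3, -, h5⟩
    exact ⟨rfl, by simp, h5, h3, by simpa [forestLabels] using h1⟩
  · rintro ⟨-, -, h3, h4, h5⟩
    simp only [forestLabels, List.flatMap_nil, List.nil_append] at h5 h3 h4
    have h1 : 1 ∈ projection t := h5.mem_iff.2 (by simp; omega)
    cases t with
    | nil => simp [projection] at h1
    | node a l r =>
      have h6 := le_of_mem_projection h4 rfl h1
      have h7 : a ∈ List.range' 1 n := h5.mem_iff.1 (by simp [projection])
      rw [List.mem_range'_1] at h7
      exact ⟨h5, by simp [rootLabel]; omega, h4, by simp, h3⟩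

theorem forests_fst_eq_nil {n j : ℕ} {p : List (BinaryTree ℕ) × BinaryTree ℕ}
    (hp : p ∈ forests n j 0) : p.1 = [] :=
  List.length_eq_zero_iff.1 (length_of_mem_forests hp)

open Classical in
theorem f_eq {n : ℕ} (hn : Even n) (h0 : n ≠ 0) (m k : ℕ) :
    f n m k = ∑ p ∈ forests n 1 0, if eoc p.2 = some m ∧ pom p.2 = some k then 1 else 0 := by
  rw [← Finset.card_filter, f]
  have : {t ∈ completeIncreasingTrees n | eoc t = some m ∧ pom t = some k} =
      ((((forests n 1 0).filter fun p => eoc p.2 = some m ∧ pom p.2 = some k).image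
        Prod.snd : Finset (BinaryTree ℕ)) : Set (BinaryTree ℕ)) := by
    ext t
    simp only [Set.mem_ofPred_eq, mem_completeIncreasingTrees_iff hn h0, Finset.coe_image,
      Set.mem_image, Finset.mem_coe, Finset.mem_filter]
    constructor
    · rintro ⟨h1, h2⟩
      exact ⟨([], t), ⟨h1, h2⟩, rfl⟩
    · rintro ⟨⟨ts, t'⟩, ⟨h1, h2⟩, rfl⟩
      obtain rfl : ts = [] := forests_fst_eq_nil h1
      exact ⟨h1, h2⟩
  rw [this, Set.ncard_coe_finset, Finset.card_image_of_injOn]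
  intro p hp q hq h
  simp only [Finset.coe_filter, Set.mem_ofPred_eq] at hp hq
  exact Prod.ext ((forests_fst_eq_nil hp.1).trans (forests_fst_eq_nil hq.1).symm) h

theorem pom_eq_some_iff {n k : ℕ} {p : List (BinaryTree ℕ) × BinaryTree ℕ}
    (hp : p ∈ forests n 1 0) : pom p.2 = some k ↔ ForestHasParent k n p := by
  have h1 := forests_fst_eq_nil hp
  have h2 := mem_forests.1 hp
  have h3 := h2.perm
  simp only [forestLabels, h1, List.flatMap_nil, List.nil_append] at h3
  have h4 : p.2.numNodes = n := by rw [← length_projection, h3.length_eq, List.length_range']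
  rw [pom, h4, parentOf_eq_some_iff h2.increasing (h3.nodup_iff.2 List.nodup_range')]
  simp [ForestHasParent, h1]

theorem exists_pom {n : ℕ} (hn : 2 ≤ n) {p : List (BinaryTree ℕ) × BinaryTree ℕ}
    (hp : p ∈ forests n 1 0) : ∃ k ∈ Finset.Icc 1 (n - 1), pom p.2 = some k := by
  simp only [pom_eq_some_iff hp]
  have h1 := forests_fst_eq_nil hp
  have h2 := mem_forests.1 hp
  have h3 := h2.perm
  simp only [forestLabels, h1, List.flatMap_nil, List.nil_append] at h3
  have hroot : rootLabel p.2 ≠ some n := by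
    intro h
    have h5 := le_of_mem_projection h2.increasing h (x := 1)
      (h3.mem_iff.2 (by rw [List.mem_range'_1]; omega))
    omega
  obtain ⟨k, hk⟩ := exists_hasParent (x := n)
    (h3.mem_iff.2 (by rw [List.mem_range'_1]; omega)) hroot
  have h5 := hk.lt h2.increasing
  have h6 := mem_range_of_mem_snd hp hk.mem_projection
  exact ⟨k, by rw [Finset.mem_Icc]; omega, Or.inr hk⟩

theorem exists_eoc_mem {n : ℕ} (hn : 2 ≤ n) {p : List (BinaryTree ℕ) × BinaryTree ℕ}
    (hp : p ∈ forests n 1 0) : ∃ m ∈ Finset.Icc 2 n, eoc p.2 = some m := by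
  obtain ⟨ts, t⟩ := p
  obtain rfl : ts = [] := forests_fst_eq_nil hp
  obtain ⟨n, rfl⟩ : ∃ n', n = n' + 1 := ⟨n - 1, by omega⟩
  have hr : ∃ l r, t = node 1 l r := by
    have h2 := (mem_forests.1 hp).perm
    simp only [forestLabels, List.flatMap_nil, List.nil_append] at h2
    have h1 : 1 ∈ projection t := h2.mem_iff.2 (by simp)
    cases t with
    | nil => simp [projection] at h1
    | node a l r =>
      have h6 := le_of_mem_projection (mem_forests.1 hp).increasing rfl h1
      have h7 := mem_range_of_mem_snd hp (x := a) (by simp [projection])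
      obtain rfl : a = 1 := by omega
      exact ⟨l, r, rfl⟩
  obtain ⟨l, r, rfl⟩ := hr
  obtain ⟨m, hm⟩ := exists_eoc (t := node 1 l r) (by simp)
  have h1 := mem_range_of_mem_snd hp (mem_projection_of_eoc hm)
  refine ⟨m, ?_, hm⟩
  have h2 : ([l], r) ∈ forests n 2 1 := by
    have h3 := mem_forests.1 hp
    rw [List.range'_succ] at h3
    exact mem_forests.2 ((isForest_spine_iff (by simp; omega)).1 h3)
  have h3 : m ≠ 1 := by
    rintro rfl
    rw [eoc_node_of_ne_nil (b := 0) (ne_nil_of_mem_forests h2 (t := l) (by simp))] at hm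
    have h4 := mem_projection_of_eoc hm
    simp only [projection, List.mem_append, List.mem_cons] at h4
    rcases h4 with h4 | h4 | h4
    · have := mem_range_of_mem_fst h2 (t := l) (by simp) h4
      omega
    · omega
    · have := mem_range_of_mem_snd h2 h4
      omega
  rw [Finset.mem_Icc]
  omega

-- Every tree has exactly one `pom` in the summation range, so summing over `k` just forgets it.
open Classical in
theorem rowSum_eq_sum {n : ℕ} (hn : Even n) (h2 : 2 ≤ n) (m : ℕ) :
    rowSum n m = ∑ p ∈ forests n 1 0, if eoc p.2 = some m then 1 else 0 := by
  simp only [rowSum, f_eq hn (by omega)]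
  rw [Finset.sum_comm]
  refine Finset.sum_congr rfl fun p hp => ?_
  obtain ⟨k, hk, hpk⟩ := exists_pom h2 hp
  rw [Finset.sum_eq_single_of_mem k hk fun k' _ hne => if_neg fun h => hne ?_]
  · simp [hpk]
  · exact Option.some.inj (h.2.symm.trans hpk)

open Classical in
theorem colSum_eq_sum {n : ℕ} (hn : Even n) (h2 : 2 ≤ n) (k : ℕ) :
    colSum n k = ∑ p ∈ forests n 1 0, if pom p.2 = some k then 1 else 0 := by
  simp only [colSum, f_eq hn (by omega)]
  rw [Finset.sum_comm]
  refine Finset.sum_congr rfl fun p hp => ?_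
  obtain ⟨m, hm, hpm⟩ := exists_eoc_mem h2 hp
  rw [Finset.sum_eq_single_of_mem m hm fun m' _ hne => if_neg fun h => hne ?_]
  · simp [hpm]
  · exact Option.some.inj (h.1.symm.trans hpm)

theorem totalSum_eq {n : ℕ} (hn : Even n) (h2 : 2 ≤ n) : totalSum n = pathCount n 0 := by
  classical
  have h : totalSum n = ∑ m ∈ Finset.Icc 2 n, rowSum n m := rfl
  simp only [h, rowSum_eq_sum hn h2]
  rw [Finset.sum_comm, ← card_forests n 1 0, Finset.card_eq_sum_ones]
  refine Finset.sum_congr rfl fun p hp => ?_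
  obtain ⟨m, hm, hpm⟩ := exists_eoc_mem h2 hp
  rw [Finset.sum_eq_single_of_mem m hm fun m' _ hne => if_neg fun h => hne ?_]
  · simp [hpm]
  · exact Option.some.inj (h.symm.trans hpm)

/-- Deleting the root `1` leaves one full tree and a spinal tree with labels from `2` on, so the
label `d + 2` is deleted at step `d` after that. -/
theorem rowSum_eq_spineEocCount {n : ℕ} (hn : Even (n + 1)) (h1 : 1 ≤ n) (d : ℕ) :
    rowSum (n + 1) (d + 2) = spineEocCount n d 0 := by
  classical
  rw [rowSum_eq_sum hn (by omega), sum_forests_succ, ← spineSum_eq d n 2 0, spineSum]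
  simp only [Finset.range_zero, Finset.sum_empty, zero_add, Nat.add_comm 2 d]
  refine Finset.sum_congr rfl fun q hq => ?_
  obtain ⟨ts, u⟩ := q
  match ts, length_of_mem_forests hq with
  | [l], _ =>
    have hl := ne_nil_of_mem_forests hq (t := l) (by simp)
    refine if_congr ?_ rfl rfl
    rw [spineJoin_cons, SpineEnds, eoc_node_of_ne_nil (b := 0) hl]

theorem colSum_eq_pomCount {n d : ℕ} (hn : Even n) (hd : d + 2 ≤ n) :
    colSum n (d + 1) = pomCount n d 0 := by
  classical
  obtain ⟨c, rfl⟩ : ∃ c, n = c + d + 2 := ⟨n - d - 2, by omega⟩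
  rw [colSum_eq_sum hn (by omega), ← card_forestHasParent d c 1 0, Finset.card_filter]
  refine Finset.sum_congr rfl fun p hp => ?_
  simp only [pom_eq_some_iff hp, show 1 + d = d + 1 by ring, show 1 + c + d + 1 = c + d + 2 by ring]

end SecantTree

/-! ### Assembly of the initial values and the recurrences. -/

open SecantTree in
theorem proposition1p3 :
    SecantTree.colSum 2 1 = 1 ∧
    (∀ n : ℕ, 2 ≤ n →
      SecantTree.colSum (2 * n) 1 = SecantTree.totalSum (2 * n - 2) ∧
      (SecantTree.colSum (2 * n) 1 : ℚ) = SecantTree.secantNumber (2 * n - 2)) ∧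
    (∀ n : ℕ, 2 ≤ n →
      SecantTree.colSum (2 * n) 2 = 3 * SecantTree.totalSum (2 * n - 2) ∧
      (SecantTree.colSum (2 * n) 2 : ℚ) = 3 * SecantTree.secantNumber (2 * n - 2)) ∧
    (∀ n m : ℕ, 2 ≤ n → 2 ≤ m → m ≤ 2 * n - 2 →
      (fwdDiff 1)^[2] (fun i : ℕ => (SecantTree.rowSum (2 * n) i : ℤ)) m
        + 4 * (SecantTree.rowSum (2 * n - 2) m : ℤ) = 0) ∧
    (∀ n k : ℕ, 2 ≤ n → 1 ≤ k → k ≤ 2 * n - 3 →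
      (fwdDiff 1)^[2] (fun j : ℕ => (SecantTree.colSum (2 * n) j : ℤ)) k
        + 4 * (SecantTree.colSum (2 * n - 2) k : ℤ) = 0) := by
  have heven : ∀ n, Even (2 * n) := fun n => even_two_mul n
  have hsub : ∀ n, 2 ≤ n → ∃ c, n = c + 2 := fun n hn => ⟨n - 2, by omega⟩
  have hcol1 : ∀ c, colSum (2 * (c + 2)) 1 = pathCount (2 * c + 2) 0 := fun c => by
    rw [colSum_eq_pomCount (d := 0) (heven _) (by omega),
      show 2 * (c + 2) = 2 * c + 3 + 1 by ring, pomCount]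
    simp
  have hcol2 : ∀ c, colSum (2 * (c + 2)) 2 = 3 * pathCount (2 * c + 2) 0 := fun c => by
    rw [colSum_eq_pomCount (d := 1) (heven _) (by omega),
      show 2 * (c + 2) = 2 * c + 2 + 1 + 1 by ring, pomCount_succ_succ (2 * c + 2 + 1) 0 0]
    -- From height 0 the only step is up to height 1. There the marked step has weight `2 * 1 + 1 =
    -- 3`, and both sides carry the same remaining path count.
    change 0 * _ + (0 + 1) * ((2 * (0 + 1) + 1) * pathCount (2 * c + 1) (0 + 1)) =
      3 * (0 * _ + (0 + 1) * pathCount (2 * c + 1) (0 + 1))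
    ring
  have htot : ∀ c, totalSum (2 * c + 2) = pathCount (2 * c + 2) 0 := fun c =>
    totalSum_eq ⟨c + 1, by ring⟩ (by omega)
  have hidx : ∀ c, 2 * (c + 2) - 2 = 2 * c + 2 := fun c => by omega
  refine ⟨?_, fun n hn => ?_, fun n hn => ?_, fun n m hn hm hm' => ?_, fun n k hn hk hk' => ?_⟩
  · rw [colSum_eq_pomCount (d := 0) (by decide) le_rfl]
    simp [pomCount, pathCount]
  · obtain ⟨c, rfl⟩ := hsub n hn
    rw [hidx, hcol1, htot, secantNumber_eq_pathCount]
    exact ⟨rfl, rfl⟩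
  · obtain ⟨c, rfl⟩ := hsub n hn
    rw [hidx, hcol2, htot, secantNumber_eq_pathCount]
    exact ⟨rfl, by push_cast; rfl⟩
  · obtain ⟨d, rfl⟩ := hsub m hm
    obtain ⟨c, hc⟩ : ∃ c, 2 * n = c + d + 3 + 1 := ⟨2 * n - d - 4, by omega⟩
    have hc' : 2 * n - 2 = c + d + 1 + 1 := by omega
    have he : Even (c + d + 3 + 1) := hc ▸ heven n
    have he' : Even (c + d + 1 + 1) := by
      rw [show c + d + 3 + 1 = c + d + 1 + 1 + 2 by ring, Nat.even_add] at he
      exact he.2 even_two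
    simp only [Function.iterate_succ, Function.iterate_zero, Function.comp_apply, id_eq, fwdDiff]
    rw [hc', hc, show d + 2 + 1 + 1 = (d + 2) + 2 by ring, show d + 2 + 1 = (d + 1) + 2 by ring,
      rowSum_eq_spineEocCount he (by omega), rowSum_eq_spineEocCount he (by omega),
      rowSum_eq_spineEocCount he (by omega), rowSum_eq_spineEocCount he' (by omega)]
    linear_combination spineEocCount_second_difference d c 0
  · obtain ⟨d, rfl⟩ : ∃ d, k = d + 1 := ⟨k - 1, by omega⟩
    obtain ⟨c, hc⟩ : ∃ c, 2 * n = c + d + 4 := ⟨2 * n - d - 4, by omega⟩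
    have hc' : 2 * n - 2 = c + d + 2 := by omega
    have he : Even (c + d + 4) := hc ▸ heven n
    have he' : Even (c + d + 2) := by
      rw [show c + d + 4 = c + d + 2 + 2 by ring, Nat.even_add] at he
      exact he.2 even_two
    simp only [Function.iterate_succ, Function.iterate_zero, Function.comp_apply, id_eq, fwdDiff]
    rw [hc', hc, show d + 1 + 1 + 1 = (d + 2) + 1 by ring,
      colSum_eq_pomCount he (by omega), colSum_eq_pomCount he (by omega),
      colSum_eq_pomCount he (by omega), colSum_eq_pomCount he' (by omega)]
    linear_combination pomCount_second_difference d c 0
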